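/- \textbf{Cylindrical Lévy–Khintchine formula.} Let $U$ be a separable real Banach space with dual $U^*$. For $a_1,\dots,a_n\in U^*$ put $\pi_{a_1,\dots,a_n}(u)=(\langle u,a_1\rangle,\dots,\langle u,a_n\rangle)\in\mathbb R^n$. A \emph{cylindrical set} is a set $\pi_{a_1,\dots,a_n}^{-1}(B)$ with $B\subseteq\mathbb R^n$ Borel; let $\mathcal Z(U)$ be the algebra of all cylindrical sets, and for $\Gamma\subseteq U^*$ let $\mathcal C(U,\Gamma)$ be the $\sigma$-algebra generated by the cylindrical sets with $a_1,\dots,a_n\in\Gamma$. A \emph{cylindrical measure} is a function $\mu:\mathcal Z(U)\to[0,\infty]$ whose restriction to $\mathcal C(U,\Gamma)$ is a measure for every finite $\Gamma\subseteq U^*$; it is a \emph{cylindrical probability measure} if $\mu(U)=1$. In that case its characteristic function is $\varphi_\mu(a)=\int_U e^{i\langle u,a\rangle}\,\mu(du)$, $a\in U^*$. The convolution of cylindrical probability measures is $(\mu_1*\mu_2)(A)=\iint 1_A(x+y)\,\mu_1(dx)\,\mu_2(dy)$, $A\in\mathcal Z(U)$, and $\mu$ is \emph{infinitely divisible} if for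 every $n\ge 1$ there is a cylindrical probability measure $\rho$ with $\mu=\rho^{*n}$. A \emph{cylindrical Lévy measure} is a cylindrical measure $\nu$ such that every image measure $\nu\circ\pi_{a_1,\dots,a_n}^{-1}$ is a Lévy measure on $\mathbb R^n$, that is, $\int_{\mathbb R^n}\min(1,|x|^2)\,(\nu\circ\pi_{a_1,\dots,a_n}^{-1})(dx)<\infty$ (its mass at the origin is not restricted and may be infinite). Let $\mu$ be an infinitely divisible cylindrical probability measure on $\mathcal Z(U)$. Then there exist a map $r:U^*\to\mathbb R$, a quadratic form $s:U^*\to\mathbb R$ and a cylindrical Lévy measure $\nu$ on $\mathcal Z(U)$ such that for all $a\in U^*$ $$\varphi_\mu(a)=\exp\Bigl(i\,r(a)-\tfrac12 s(a)+\int_{\mathbb R\setminus\{0\}}\bigl(e^{i\gamma}-1-i\gamma\,1_{B_1}(\gamma)\bigr)\,(\nu\circ a^{-1})(d\gamma)\Bigr),\qquad B_1=\{\gamma\in\mathbb R:|\gamma|\le 1\}.$$ -/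

import Mathlib

open MeasureTheory
open scoped ENNReal

noncomputable section

section CylindricalSets

variable {U : Type*} [NormedAddCommGroup U] [NormedSpace ℝ U]

/-- The map `u ↦ (⟨u, a 1⟩, …, ⟨u, a n⟩)` from `U` to `ℝⁿ`. -/
def cylProj {n : ℕ} (a : Fin n → StrongDual ℝ U) (u : U) : EuclideanSpace ℝ (Fin n) :=
  WithLp.toLp 2 fun i => a i u

/-- The cylindrical sets `{u | (⟨u, a 1⟩, …, ⟨u, a n⟩) ∈ B}` with `a 1, …, a n ∈ Γ` and `B` a Borel
subset of `ℝⁿ`. -/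
def cylSets (Γ : Set (StrongDual ℝ U)) : Set (Set U) :=
  {S | ∃ (n : ℕ) (a : Fin n → StrongDual ℝ U) (B : Set (EuclideanSpace ℝ (Fin n))),
    (∀ i, a i ∈ Γ) ∧ MeasurableSet B ∧ S = cylProj a ⁻¹' B}

/-- The cylindrical σ-algebra with respect to `Γ`, generated by the cylindrical sets. -/
@[reducible] def cylSigma (Γ : Set (StrongDual ℝ U)) : MeasurableSpace U :=
  MeasurableSpace.generateFrom (cylSets Γ)

theorem cylSets_mono {Γ Γ' : Set (StrongDual ℝ U)} (h : Γ ⊆ Γ') : cylSets Γ ⊆ cylSets Γ' := by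
  rintro S ⟨n, a, B, ha, hB, rfl⟩
  exact ⟨n, a, B, fun i => h (ha i), hB, rfl⟩

theorem cylSigma_mono {Γ Γ' : Set (StrongDual ℝ U)} (h : Γ ⊆ Γ') : cylSigma Γ ≤ cylSigma Γ' :=
  MeasurableSpace.generateFrom_mono (cylSets_mono h)

theorem measurable_cylProj {Γ : Set (StrongDual ℝ U)} {n : ℕ} {a : Fin n → StrongDual ℝ U}
    (ha : ∀ i, a i ∈ Γ) : @Measurable U (EuclideanSpace ℝ (Fin n)) (cylSigma Γ) _ (cylProj a) :=
  fun B hB => MeasurableSpace.measurableSet_generateFrom ⟨n, a, B, ha, hB, rfl⟩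

theorem measurable_apply_cylSigma {Γ : Set (StrongDual ℝ U)} {a : StrongDual ℝ U} (ha : a ∈ Γ) :
    @Measurable U ℝ (cylSigma Γ) _ a := by
  have h := measurable_cylProj (Γ := Γ) (a := fun _ : Fin 1 => a) (fun _ => ha)
  have h2 : Measurable (fun x : EuclideanSpace ℝ (Fin 1) => x 0) := by fun_prop
  exact h2.comp h

/-- For finite `Γ = {a 1, …, a n}` the cylindrical σ-algebra is the pullback of the Borel
σ-algebra of `ℝⁿ`. -/
theorem cylSigma_range {n : ℕ} (a : Fin n → StrongDual ℝ U) :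
    cylSigma (Set.range a) = MeasurableSpace.comap (cylProj a) inferInstance := by
  apply le_antisymm
  · refine MeasurableSpace.generateFrom_le ?_
    rintro S ⟨k, b, B, hb, hB, rfl⟩
    choose j hj using hb
    refine ⟨(fun x : EuclideanSpace ℝ (Fin n) =>
      (WithLp.toLp 2 fun i => x (j i) : EuclideanSpace ℝ (Fin k))) ⁻¹' B, ?_, ?_⟩
    · have : Measurable (fun x : EuclideanSpace ℝ (Fin n) =>
        (WithLp.toLp 2 fun i => x (j i) : EuclideanSpace ℝ (Fin k))) := by fun_prop
      exact this hB
    · ext u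
      simp [cylProj, hj]
  · rintro S ⟨B, hB, rfl⟩
    exact measurable_cylProj (fun i => Set.mem_range_self i) hB

/-- For finite `Γ` every set of the cylindrical σ-algebra is a cylindrical set. -/
theorem mem_cylSets_of_measurableSet {Γ : Set (StrongDual ℝ U)} (hΓ : Γ.Finite) {S : Set U}
    (hS : MeasurableSet[cylSigma Γ] S) : S ∈ cylSets Γ := by
  obtain ⟨n, a, rfl⟩ : ∃ (n : ℕ) (a : Fin n → StrongDual ℝ U), Γ = Set.range a := by
    obtain ⟨n, a, -, h⟩ := hΓ.fin_param
    exact ⟨n, a, h.symm⟩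
  rw [cylSigma_range] at hS
  obtain ⟨B, hB, rfl⟩ := hS
  exact ⟨n, a, B, fun i => Set.mem_range_self i, hB, rfl⟩

theorem exists_finite_measurableSet {S : Set U} (hS : S ∈ cylSets (Set.univ : Set (StrongDual ℝ U))) :
    ∃ Γ : Set (StrongDual ℝ U), Γ.Finite ∧ MeasurableSet[cylSigma Γ] S := by
  obtain ⟨n, a, B, -, hB, rfl⟩ := hS
  exact ⟨Set.range a, Set.finite_range a, measurable_cylProj (fun i => Set.mem_range_self i) hB⟩

theorem univ_mem_cylSets (Γ : Set (StrongDual ℝ U)) : Set.univ ∈ cylSets Γ :=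
  ⟨0, Fin.elim0, Set.univ, fun i => i.elim0, MeasurableSet.univ, rfl⟩

theorem measurable_add_cylSigma (Γ : Set (StrongDual ℝ U)) :
    @Measurable (U × U) U (@Prod.instMeasurableSpace U U (cylSigma Γ) (cylSigma Γ)) (cylSigma Γ)
      (fun p => p.1 + p.2) := by
  let _ := cylSigma Γ
  refine measurable_generateFrom ?_
  rintro S ⟨n, a, B, ha, hB, rfl⟩
  have h : Measurable (fun p : U × U => cylProj a p.1 + cylProj a p.2) :=
    ((measurable_cylProj ha).comp measurable_fst).add ((measurable_cylProj ha).comp measurable_snd)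
  have h2 : (fun p : U × U => p.1 + p.2) ⁻¹' (cylProj a ⁻¹' B)
      = (fun p : U × U => cylProj a p.1 + cylProj a p.2) ⁻¹' B := by
    ext p
    have : cylProj a (p.1 + p.2) = cylProj a p.1 + cylProj a p.2 := by
      ext i; simp [cylProj]
    simp [this]
  rw [h2]
  exact h hB

end CylindricalSets

/-- A cylindrical measure on `U`: a function on the algebra of all cylindrical sets whose
restriction to the cylindrical σ-algebra of each finite set of functionals is a measure. -/
@[ext] structure CylindricalMeasure (U : Type*) [NormedAddCommGroup U] [NormedSpace ℝ U] where
  toFun : cylSets (Set.univ : Set (StrongDual ℝ U)) → ℝ≥0∞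
  isMeasure : ∀ Γ : Set (StrongDual ℝ U), Γ.Finite → ∃ m : @Measure U (cylSigma Γ),
    ∀ S : cylSets (Set.univ : Set (StrongDual ℝ U)), MeasurableSet[cylSigma Γ] (S : Set U) →
      m S = toFun S

namespace CylindricalMeasure

variable {U : Type*} [NormedAddCommGroup U] [NormedSpace ℝ U]

/-- The restriction of a cylindrical measure to the cylindrical σ-algebra of a finite set `Γ`. -/
def toMeasure (μ : CylindricalMeasure U) (Γ : Set (StrongDual ℝ U)) (hΓ : Γ.Finite) :
    @Measure U (cylSigma Γ) :=
  (μ.isMeasure Γ hΓ).choose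

theorem toMeasure_apply (μ : CylindricalMeasure U) {Γ : Set (StrongDual ℝ U)} (hΓ : Γ.Finite)
    (S : cylSets (Set.univ : Set (StrongDual ℝ U))) (hS : MeasurableSet[cylSigma Γ] (S : Set U)) :
    μ.toMeasure Γ hΓ S = μ.toFun S :=
  (μ.isMeasure Γ hΓ).choose_spec S hS

/-- The image measure of `μ` under `(a 1, …, a n)`, a Borel measure on `ℝⁿ`. -/
def image (μ : CylindricalMeasure U) {n : ℕ} (a : Fin n → StrongDual ℝ U) :
    Measure (EuclideanSpace ℝ (Fin n)) :=
  @Measure.map U (EuclideanSpace ℝ (Fin n)) (cylSigma (Set.range a)) _ (cylProj a)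
    (μ.toMeasure (Set.range a) (Set.finite_range a))

theorem image_apply (μ : CylindricalMeasure U) {n : ℕ} (a : Fin n → StrongDual ℝ U)
    {B : Set (EuclideanSpace ℝ (Fin n))} (hB : MeasurableSet B) :
    μ.image a B = μ.toFun ⟨cylProj a ⁻¹' B, n, a, B, fun _ => Set.mem_univ _, hB, rfl⟩ := by
  have h := measurable_cylProj (Γ := Set.range a) (a := a) (fun i => Set.mem_range_self i)
  rw [image, @Measure.map_apply _ _ (cylSigma (Set.range a)) _ _ _ h _ hB]
  exact μ.toMeasure_apply (Set.finite_range a)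
    ⟨cylProj a ⁻¹' B, n, a, B, fun _ => Set.mem_univ _, hB, rfl⟩ (h hB)

/-- The image measure of `μ` under a single functional `a`, a Borel measure on `ℝ`. -/
def image₁ (μ : CylindricalMeasure U) (a : StrongDual ℝ U) : Measure ℝ :=
  @Measure.map U ℝ (cylSigma {a}) _ a (μ.toMeasure {a} (Set.finite_singleton a))

/-- The characteristic function `a ↦ ∫ exp (i ⟨u, a⟩) μ(du)`, the integral being taken with respect
to the restriction of `μ` to the cylindrical σ-algebra of `{a}`. -/
def charFn (μ : CylindricalMeasure U) (a : StrongDual ℝ U) : ℂ :=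
  ∫ u, Complex.exp (Complex.I * (a u : ℂ)) ∂(μ.toMeasure {a} (Set.finite_singleton a))

end CylindricalMeasure

/-- Cylindrical probability measures on `U`. -/
def CylindricalProbabilityMeasure (U : Type*) [NormedAddCommGroup U] [NormedSpace ℝ U] : Type _ :=
  {μ : CylindricalMeasure U // μ.toFun ⟨Set.univ, univ_mem_cylSets _⟩ = 1}

namespace CylindricalProbabilityMeasure

variable {U : Type*} [NormedAddCommGroup U] [NormedSpace ℝ U]

theorem isProbabilityMeasure_toMeasure (μ : CylindricalProbabilityMeasure U)
    {Γ : Set (StrongDual ℝ U)} (hΓ : Γ.Finite) :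
    @IsProbabilityMeasure U (cylSigma Γ) (μ.1.toMeasure Γ hΓ) := by
  let _ := cylSigma Γ
  exact ⟨(μ.1.toMeasure_apply hΓ ⟨Set.univ, univ_mem_cylSets _⟩ MeasurableSet.univ).trans μ.2⟩

/-- The convolution on the cylindrical σ-algebra of a finite set `Γ`: the image of the product
measure under addition. -/
def convOn (μ₁ μ₂ : CylindricalProbabilityMeasure U) (Γ : Set (StrongDual ℝ U)) (hΓ : Γ.Finite) :
    @Measure U (cylSigma Γ) :=
  letI := cylSigma Γ
  ((μ₁.1.toMeasure Γ hΓ).prod (μ₂.1.toMeasure Γ hΓ)).map fun p => p.1 + p.2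

theorem toMeasure_eq_map (μ : CylindricalMeasure U) {Γ Γ' : Set (StrongDual ℝ U)}
    (hΓ : Γ.Finite) (hΓ' : Γ'.Finite) (h : Γ ⊆ Γ') :
    μ.toMeasure Γ hΓ
      = @Measure.map U U (cylSigma Γ') (cylSigma Γ) id (μ.toMeasure Γ' hΓ') := by
  refine @Measure.ext U (cylSigma Γ) _ _ fun S hS => ?_
  have hS' : S ∈ cylSets (Set.univ : Set (StrongDual ℝ U)) :=
    cylSets_mono (Set.subset_univ _) (mem_cylSets_of_measurableSet hΓ hS)
  rw [@Measure.map_apply U U (cylSigma Γ') (cylSigma Γ) _ id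
    (measurable_id'' (cylSigma_mono h)) S hS]
  exact (μ.toMeasure_apply hΓ ⟨S, hS'⟩ hS).trans
    (μ.toMeasure_apply hΓ' ⟨S, hS'⟩ (cylSigma_mono h S hS)).symm

theorem convOn_mono (μ₁ μ₂ : CylindricalProbabilityMeasure U) {Γ Γ' : Set (StrongDual ℝ U)}
    (hΓ : Γ.Finite) (hΓ' : Γ'.Finite) (h : Γ ⊆ Γ') {S : Set U}
    (hS : MeasurableSet[cylSigma Γ] S) : convOn μ₁ μ₂ Γ hΓ S = convOn μ₁ μ₂ Γ' hΓ' S := by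
  have hid : @Measurable U U (cylSigma Γ') (cylSigma Γ) id := measurable_id'' (cylSigma_mono h)
  have := μ₁.isProbabilityMeasure_toMeasure hΓ'
  have := μ₂.isProbabilityMeasure_toMeasure hΓ'
  unfold convOn
  rw [@Measure.map_apply _ _ _ (cylSigma Γ) _ _ (measurable_add_cylSigma Γ) _ hS,
    @Measure.map_apply _ _ _ (cylSigma Γ') _ _ (measurable_add_cylSigma Γ') _
      (cylSigma_mono h S hS),
    toMeasure_eq_map μ₁.1 hΓ hΓ' h, toMeasure_eq_map μ₂.1 hΓ hΓ' h,
    @Measure.map_prod_map U U U (cylSigma Γ') (cylSigma Γ) (cylSigma Γ') U (cylSigma Γ)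
      id id _ _ _ _ hid hid,
    @Measure.map_apply _ _ _ (@Prod.instMeasurableSpace U U (cylSigma Γ) (cylSigma Γ)) _ _
      (@Measurable.prodMap U U U U (cylSigma Γ') (cylSigma Γ) (cylSigma Γ') (cylSigma Γ) id id
        hid hid) _ (measurable_add_cylSigma Γ hS)]
  rfl

theorem convOn_congr (μ₁ μ₂ : CylindricalProbabilityMeasure U) {Γ Γ' : Set (StrongDual ℝ U)}
    (hΓ : Γ.Finite) (hΓ' : Γ'.Finite) {S : Set U} (hS : MeasurableSet[cylSigma Γ] S)
    (hS' : MeasurableSet[cylSigma Γ'] S) : convOn μ₁ μ₂ Γ hΓ S = convOn μ₁ μ₂ Γ' hΓ' S :=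
  (convOn_mono μ₁ μ₂ hΓ (hΓ.union hΓ') Set.subset_union_left hS).trans
    (convOn_mono μ₁ μ₂ hΓ' (hΓ.union hΓ') Set.subset_union_right hS').symm

/-- The convolution `A ↦ ∫∫ 1_A (x + y) μ₁(dx) μ₂(dy)`, computed on the σ-algebra of any finite set
of functionals that makes the cylindrical set `A` measurable. -/
def conv (μ₁ μ₂ : CylindricalProbabilityMeasure U) : CylindricalProbabilityMeasure U :=
  ⟨{ toFun := fun A => convOn μ₁ μ₂ (exists_finite_measurableSet A.2).choose
        (exists_finite_measurableSet A.2).choose_spec.1 A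
     isMeasure := fun Γ hΓ => ⟨convOn μ₁ μ₂ Γ hΓ, fun S hS =>
        convOn_congr μ₁ μ₂ hΓ _ hS (exists_finite_measurableSet S.2).choose_spec.2⟩ }, by
    have hΓ := (exists_finite_measurableSet (univ_mem_cylSets (U := U) Set.univ)).choose_spec.1
    have := μ₁.isProbabilityMeasure_toMeasure hΓ
    have := μ₂.isProbabilityMeasure_toMeasure hΓ
    change convOn μ₁ μ₂ _ hΓ Set.univ = 1
    unfold convOn
    rw [@Measure.map_apply _ _ _ (cylSigma _) _ _ (measurable_add_cylSigma _) _
      (@MeasurableSet.univ _ (cylSigma _)), Set.preimage_univ, measure_univ]⟩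

/-- The unit mass at the origin. -/
def diracZero : CylindricalProbabilityMeasure U :=
  ⟨{ toFun := fun A => Set.indicator (A : Set U) 1 0
     isMeasure := fun Γ _ => ⟨@Measure.dirac U (cylSigma Γ) 0, fun S hS =>
       @Measure.dirac_apply' U (cylSigma Γ) _ 0 hS⟩ }, by simp⟩

/-- The `n`-fold convolution of `μ` with itself. -/
def convPow (μ : CylindricalProbabilityMeasure U) : ℕ → CylindricalProbabilityMeasure U
  | 0 => diracZero
  | n + 1 => conv (convPow μ n) μ

/-- `μ` is infinitely divisible if it has an `n`-th convolution root for every `n ≥ 1`. -/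
def IsInfinitelyDivisible (μ : CylindricalProbabilityMeasure U) : Prop :=
  ∀ n : ℕ, 1 ≤ n → ∃ ρ : CylindricalProbabilityMeasure U, μ = convPow ρ n

end CylindricalProbabilityMeasure

/-- Lévy measures on `ℝⁿ`: `∫ min(1, |x|²) ν(dx) < ∞`. A Lévy measure is regarded as a measure on
the complement of the origin, so its (possibly infinite) mass at the origin is not constrained; note
that `ν ∘ a⁻¹` may charge `{0}`, for instance when `a = 0`. -/
def IsLevyMeasure {n : ℕ} (ν : Measure (EuclideanSpace ℝ (Fin n))) : Prop :=
  ∫⁻ x, min 1 (‖x‖ₑ ^ 2) ∂ν < ∞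

/-- A cylindrical Lévy measure: all finite-dimensional image measures are Lévy measures. -/
def CylindricalMeasure.IsLevy {U : Type*} [NormedAddCommGroup U] [NormedSpace ℝ U]
    (ν : CylindricalMeasure U) : Prop :=
  ∀ (n : ℕ) (a : Fin n → StrongDual ℝ U), IsLevyMeasure (ν.image a)

end

/-! ### Uniform estimates for convolution roots on the line -/

section RootEstimates

open Filter Topology

variable {P : Measure ℝ} {Q : ℕ → Measure ℝ} [IsProbabilityMeasure P]
  [∀ n, IsProbabilityMeasure (Q n)]

/-! Choose `ρ n` with (n+1)-fold convolution power `μ`. In every direction the characteristic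
function of `ρ n` is then an (n+1)-th root of that of `μ`, which forces uniform bounds on the
truncated second moments and tails of `(n+1) ρ n`. Weighted by `min(1,|x|²)`, the image measures on
`ℝᵈ` are therefore bounded and tight, so by Prokhorov they converge along any ultrafilter. Dividing
the limit by the weight away from the origin gives a Lévy measure for each tuple of functionals
(`exists_isLevyLimit`). The mass left at the origin is the Gaussian contribution; tests of order
`min(1,|x|³)` do not see it.

There are in general uncountably many tuples, so one fixed ultrafilter replaces subsequences: all
limits exist along the same filter, and consistency of the limits is just uniqueness of limits
(`measure_eq_measure_preimage`). The family glues to a cylindrical measure once infinite mass is put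
at the origin, where nothing is known to be consistent (`exists_cylindricalMeasure_of_consistent`).

Along the same ultrafilter `(n+1)(φ_{ρ n}(a) - 1)` converges to some `z a`, and `(1 + g)^(n+1) → exp
z` yields `φ_μ(a) = exp (z a)`. Define `s` as what remains of `-2 Re z` after subtracting `∫ 2(1 -
cos γ) dν`. Whenever `∑ w_j f_j² = 0` for linear `f_j`, the combination `∑ w_j 2(1 - cos f_j)` is of
third order, so its limit is exactly its `ν`-integral and the corresponding combination of values of
`s` vanishes (`sum_gaussianPart_eq_zero`). The laws of a quadratic form are relations of this kind.
The map `r` is unrestricted and absorbs the remaining imaginary part. -/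

theorem exists_forall_norm_one_sub_charFun_root_le
    (h : ∀ n t, charFun (Q n) t ^ (n + 1) = charFun P t) {ε : ℝ} (hε : 0 < ε) :
    ∃ δ > 0, ∀ (n : ℕ) t, |t| ≤ δ → (n + 1 : ℝ) * ‖1 - charFun (Q n) t‖ ≤ ε := by
  have hφ : Continuous (charFun P) := continuous_charFun
  have h0 : charFun P 0 = 1 := by simp
  have hlog : ContinuousAt (fun t => Complex.log (charFun P t)) 0 :=
    hφ.continuousAt.clog (by simp [h0])
  have hlim : ∀ᶠ t in 𝓝 (0 : ℝ), charFun P t ∈ Complex.slitPlane ∧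
      ‖Complex.log (charFun P t)‖ < min (ε / 2) 1 := by
    refine (hφ.continuousAt.eventually_mem
      (Complex.isOpen_slitPlane.mem_nhds (by simp [h0]))).and ?_
    -- The bound `ε / 2` pays for the factor 2 in `|exp w - 1| ≤ 2|w|`; the bound 1 keeps `w` where
    -- that inequality holds.
    refine hlog.norm.eventually_lt_const ?_
    simp [h0, hε]
  obtain ⟨δ', hδ', hball⟩ := Metric.eventually_nhds_iff.1 hlim
  have key : ∀ t, |t| ≤ δ' / 2 → charFun P t ∈ Complex.slitPlane ∧
      ‖Complex.log (charFun P t)‖ < min (ε / 2) 1 := fun t ht =>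
    hball (by rw [Real.dist_eq, sub_zero]; linarith)
  refine ⟨δ' / 2, by positivity, fun n t ht => ?_⟩
  set w : ℝ → ℂ := fun t => Complex.log (charFun P t) / (n + 1 : ℕ) with hw
  have hn : ((n + 1 : ℕ) : ℂ) ≠ 0 := by exact_mod_cast n.succ_ne_zero
  have hwpow : ∀ s, |s| ≤ δ' / 2 → Complex.exp (w s) ^ (n + 1) = charFun P s := by
    intro s hs
    rw [← Complex.exp_nat_mul, hw]
    simp only
    rw [mul_div_cancel₀ _ hn, Complex.exp_log (Complex.slitPlane_ne_zero (key s hs).1)]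
  have hqcont : ContinuousOn (fun s => charFun (Q n) s / Complex.exp (w s))
      (Set.Icc (-(δ' / 2)) (δ' / 2)) := by
    have h1 : Continuous (charFun (Q n)) := continuous_charFun
    refine h1.continuousOn.div ?_ fun s _ => Complex.exp_ne_zero _
    exact ((hφ.continuousOn.clog fun s hs => (key s (abs_le.2 hs)).1).div_const _).cexp
  have hfin : {z : ℂ | z ^ (n + 1) = 1}.Finite := by
    have : {z : ℂ | z ^ (n + 1) = 1} ⊆ ((Polynomial.nthRoots (n + 1) (1 : ℂ)).toFinset : Set ℂ) := by
      intro z hz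
      simpa [Polynomial.mem_nthRoots] using hz
    exact (Finset.finite_toSet _).subset this
  -- The quotient of the root by the principal root `exp (log φ / (n+1))` is continuous with values
  -- in a finite set of roots of unity, hence constant on the interval and equal to its value 1 at
  -- the origin. The interval does not depend on `n`.
  have hmaps : Set.MapsTo (fun s => charFun (Q n) s / Complex.exp (w s))
      (Set.Icc (-(δ' / 2)) (δ' / 2)) {z : ℂ | z ^ (n + 1) = 1} := by
    intro s hs
    have hs' := abs_le.2 hs
    change (charFun (Q n) s / Complex.exp (w s)) ^ (n + 1) = 1
    rw [div_pow, h, hwpow s hs', div_self (Complex.slitPlane_ne_zero (key s hs').1)]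
  have hconst := isPreconnected_Icc.constant_of_mapsTo hfin.isDiscrete hqcont hmaps (abs_le.1 ht)
    (show (0 : ℝ) ∈ Set.Icc (-(δ' / 2)) (δ' / 2) by constructor <;> linarith)
  have heq : charFun (Q n) t = Complex.exp (w t) := by
    have hw0 : w 0 = 0 := by simp [hw]
    simp only [hw0, charFun_zero, Complex.exp_zero, probReal_univ] at hconst
    rw [div_eq_iff (Complex.exp_ne_zero _)] at hconst
    simpa using hconst
  have hb := (key t ht).2
  have hwn : (n + 1 : ℝ) * ‖w t‖ = ‖Complex.log (charFun P t)‖ := by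
    simp only [hw, norm_div, Complex.norm_natCast]
    push_cast
    field_simp
  have hw1 : ‖w t‖ ≤ 1 := by
    have h1 := hb.trans_le (min_le_right _ _)
    rw [← hwn] at h1
    nlinarith [norm_nonneg (w t), (n.cast_nonneg : (0 : ℝ) ≤ n)]
  rw [heq, norm_sub_rev]
  calc (n + 1 : ℝ) * ‖Complex.exp (w t) - 1‖ ≤ (n + 1 : ℝ) * (2 * ‖w t‖) := by
        gcongr
        exact Complex.norm_exp_sub_one_le hw1
    _ = 2 * ‖Complex.log (charFun P t)‖ := by rw [← hwn]; ring
    _ ≤ ε := by linarith [min_le_left (ε / 2) 1]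

/-- Tails are controlled by the average of `1 - φ` near the origin; the radius `2 / δ` makes that
average run over `[-δ, δ]`, where the previous estimate applies. -/
theorem exists_forall_measureReal_root_abs_gt_le
    (h : ∀ n t, charFun (Q n) t ^ (n + 1) = charFun P t) {ε : ℝ} (hε : 0 < ε) :
    ∃ R > 0, ∀ n : ℕ, (n + 1 : ℝ) * (Q n).real {x | R < |x|} ≤ ε := by
  obtain ⟨δ, hδ, hb⟩ := exists_forall_norm_one_sub_charFun_root_le h (half_pos hε)
  refine ⟨2 / δ, by positivity, fun n => ?_⟩
  have hn : (0 : ℝ) < n + 1 := by positivity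
  have h1 := measureReal_abs_gt_le_integral_charFun (μ := Q n) (r := 2 / δ) (by positivity)
  have e1 : -2 * (2 / δ)⁻¹ = -δ := by field_simp
  have e2 : 2 * (2 / δ)⁻¹ = δ := by field_simp
  rw [e1, e2] at h1
  have h2 : ‖∫ t in (-δ)..δ, 1 - charFun (Q n) t‖ ≤ ε / 2 / (n + 1) * |δ - -δ| := by
    refine intervalIntegral.norm_integral_le_of_norm_le_const fun t ht => ?_
    rw [Set.uIoc_of_le (by linarith)] at ht
    rw [le_div_iff₀ hn, mul_comm]
    exact hb n t (abs_le.2 ⟨ht.1.le, ht.2⟩)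
  rw [abs_of_pos (by linarith)] at h2
  calc (n + 1 : ℝ) * (Q n).real {x | 2 / δ < |x|}
      ≤ (n + 1) * (2⁻¹ * (2 / δ) * (ε / 2 / (n + 1) * (δ - -δ))) := by
        gcongr
        exact h1.trans (by gcongr)
    _ = ε := by field_simp; ring

theorem sq_le_four_mul_one_sub_cos {y : ℝ} (hy : |y| ≤ 1) : y ^ 2 ≤ 4 * (1 - Real.cos y) := by
  have h1 := (abs_le.1 (Real.cos_bound hy)).2
  have h2 : |y| ^ 4 ≤ y ^ 2 := by
    rw [← sq_abs y]
    exact pow_le_pow_of_le_one (abs_nonneg y) hy (by norm_num)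
  nlinarith [sq_nonneg y]

theorem integral_one_sub_cos_le (Q : Measure ℝ) [IsProbabilityMeasure Q] (t : ℝ) :
    ∫ x, (1 - Real.cos (t * x)) ∂Q ≤ ‖1 - charFun Q t‖ := by
  have hint : Integrable (fun x : ℝ => Complex.exp (t * x * Complex.I)) Q := by
    refine Integrable.of_bound (C := 1) (by fun_prop) (ae_of_all _ fun x => ?_)
    rw [← Complex.ofReal_mul, Complex.norm_exp_ofReal_mul_I]
  have h1 : (1 - charFun Q t).re = ∫ x, (1 - Real.cos (t * x)) ∂Q := by
    have h2 : 1 - charFun Q t = ∫ x : ℝ, (1 - Complex.exp (t * x * Complex.I)) ∂Q := by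
      rw [integral_sub (integrable_const _) hint, charFun_apply_real]
      simp
    have h3 := integral_re ((integrable_const (1 : ℂ)).sub hint)
    rw [h2]
    simp only [RCLike.re_eq_complex_re, Pi.sub_apply] at h3
    rw [← h3]
    congr 1 with x
    rw [← Complex.ofReal_mul]
    rw [Complex.sub_re, Complex.exp_ofReal_mul_I_re, Complex.one_re]
  rw [← h1]
  exact Complex.re_le_norm _

theorem exists_forall_integral_min_one_sq_root_le
    (h : ∀ n t, charFun (Q n) t ^ (n + 1) = charFun P t) :
    ∃ C, ∀ n : ℕ, (n + 1 : ℝ) * ∫ x, min 1 (x ^ 2) ∂(Q n) ≤ C := by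
  obtain ⟨δ, hδ, hb⟩ := exists_forall_norm_one_sub_charFun_root_le h one_pos
  obtain ⟨R, hR, ht⟩ := exists_forall_measureReal_root_abs_gt_le h one_pos
  -- Small enough both for the estimate of `1 - φ` at `t` and for `|t x| ≤ 1` on `|x| ≤ R`, where `1
  -- - cos (t x)` dominates a multiple of `x²`.
  set t := min δ (1 / R) with htdef
  have htpos : 0 < t := lt_min hδ (by positivity)
  refine ⟨1 + 4 / t ^ 2, fun n => ?_⟩
  have hn : (0 : ℝ) < n + 1 := by positivity
  have hpt : ∀ x : ℝ, min 1 (x ^ 2) ≤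
      Set.indicator {x | R < |x|} (fun _ => (1 : ℝ)) x + 4 / t ^ 2 * (1 - Real.cos (t * x)) := by
    intro x
    have hcos := Real.cos_le_one (t * x)
    by_cases hx : R < |x|
    · rw [Set.indicator_of_mem (by exact hx)]
      have : 0 ≤ 4 / t ^ 2 * (1 - Real.cos (t * x)) := mul_nonneg (by positivity) (by linarith)
      linarith [min_le_left 1 (x ^ 2)]
    · rw [Set.indicator_of_notMem (by exact hx), zero_add]
      have hle : |t * x| ≤ 1 := by
        rw [abs_mul, abs_of_pos htpos]
        calc t * |x| ≤ 1 / R * R := by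
              gcongr
              · exact min_le_right _ _
              · exact not_lt.1 hx
          _ = 1 := by field_simp
      have h3 := sq_le_four_mul_one_sub_cos hle
      refine (min_le_right _ _).trans ?_
      rw [div_mul_eq_mul_div, le_div_iff₀ (by positivity)]
      linarith [mul_pow t x 2]
  have hms : MeasurableSet {x : ℝ | R < |x|} := measurableSet_lt (by fun_prop) (by fun_prop)
  have hi1 : Integrable (Set.indicator {x : ℝ | R < |x|} (fun _ => (1 : ℝ))) (Q n) :=
    (integrable_const _).indicator hms
  have hi2 : Integrable (fun x => 1 - Real.cos (t * x)) (Q n) := by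
    refine Integrable.of_bound (C := 2) (by fun_prop) (ae_of_all _ fun x => ?_)
    rw [Real.norm_eq_abs, abs_le]
    constructor <;> linarith [Real.cos_le_one (t * x), Real.neg_one_le_cos (t * x)]
  have hi0 : Integrable (fun x : ℝ => min 1 (x ^ 2)) (Q n) := by
    refine Integrable.of_bound (C := 1) (by fun_prop) (ae_of_all _ fun x => ?_)
    rw [Real.norm_of_nonneg (by positivity)]
    exact min_le_left _ _
  have h4 : ∫ x, min 1 (x ^ 2) ∂(Q n) ≤
      (Q n).real {x | R < |x|} + 4 / t ^ 2 * ‖1 - charFun (Q n) t‖ := by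
    refine (integral_mono hi0 (hi1.add (hi2.const_mul _)) hpt).trans ?_
    rw [integral_add' hi1 (hi2.const_mul _), integral_indicator_const _ hms,
      integral_const_mul]
    simp only [smul_eq_mul, mul_one]
    gcongr
    exact integral_one_sub_cos_le _ _
  have h5 := hb n t (by rw [abs_of_pos htpos]; exact min_le_left _ _)
  calc (n + 1 : ℝ) * ∫ x, min 1 (x ^ 2) ∂(Q n)
      ≤ (n + 1) * ((Q n).real {x | R < |x|} + 4 / t ^ 2 * ‖1 - charFun (Q n) t‖) := by gcongr
    _ = (n + 1) * (Q n).real {x | R < |x|} + 4 / t ^ 2 * ((n + 1) * ‖1 - charFun (Q n) t‖) := by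
        ring
    _ ≤ 1 + 4 / t ^ 2 * 1 := by
        gcongr
        exact ht n
    _ = 1 + 4 / t ^ 2 := by ring

theorem norm_exp_mul_I_sub_one_sub_le {y : ℝ} (hy : |y| ≤ 1) :
    ‖Complex.exp (y * Complex.I) - 1 - y * Complex.I‖ ≤ y ^ 2 := by
  have := Complex.norm_exp_sub_one_sub_id_le (x := y * Complex.I) (by simpa using hy)
  simpa using this

/-- The bound near the origin need not reach the argument 1. In `(e^{ix} - 1) - t⁻¹(e^{itx} - 1)`
the linear terms cancel, so the difference is `O(min(1, x²))` and the truncated second moment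
carries the bound from a small `t` to 1. -/
theorem exists_forall_norm_charFun_root_one_sub_one_le
    (h : ∀ n t, charFun (Q n) t ^ (n + 1) = charFun P t) :
    ∃ C, ∀ n : ℕ, (n + 1 : ℝ) * ‖charFun (Q n) 1 - 1‖ ≤ C := by
  obtain ⟨δ, hδ, hb⟩ := exists_forall_norm_one_sub_charFun_root_le h one_pos
  obtain ⟨C, hC⟩ := exists_forall_integral_min_one_sq_root_le h
  set t := min δ 1 with htdef
  have htpos : 0 < t := lt_min hδ one_pos
  have ht1 : t ≤ 1 := min_le_right _ _
  have hE : ∀ s x : ℝ, ‖Complex.exp (s * x * Complex.I)‖ = 1 := fun s x => by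
    rw [← Complex.ofReal_mul, Complex.norm_exp_ofReal_mul_I]
  have hpt : ∀ x : ℝ, ‖(Complex.exp ((1 : ℝ) * x * Complex.I) - 1)
      - (1 / t : ℝ) * (Complex.exp (t * x * Complex.I) - 1)‖ ≤ (2 + 2 / t) * min 1 (x ^ 2) := by
    intro x
    have h2 : ∀ s : ℝ, ‖Complex.exp (s * x * Complex.I) - 1‖ ≤ 2 := fun s =>
      (norm_sub_le _ _).trans (by rw [hE, norm_one]; norm_num)
    rcases le_or_gt |x| 1 with hx | hx
    · have hx2 : x ^ 2 ≤ 1 := by rw [← sq_abs]; exact pow_le_one₀ (abs_nonneg _) hx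
      rw [min_eq_right hx2]
      have htx : |t * x| ≤ 1 := by
        rw [abs_mul, abs_of_pos htpos]
        exact mul_le_one₀ ht1 (abs_nonneg _) hx
      have h3 := norm_exp_mul_I_sub_one_sub_le hx
      have h4 := norm_exp_mul_I_sub_one_sub_le htx
      have htc : (t : ℂ) ≠ 0 := by exact_mod_cast htpos.ne'
      have e : (Complex.exp ((1 : ℝ) * x * Complex.I) - 1)
          - (1 / t : ℝ) * (Complex.exp (t * x * Complex.I) - 1)
          = (Complex.exp (x * Complex.I) - 1 - x * Complex.I)
            - (1 / t : ℝ) * (Complex.exp ((t * x : ℝ) * Complex.I) - 1 - (t * x : ℝ) * Complex.I) := by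
        push_cast
        rw [one_mul]
        field_simp
        ring
      rw [e]
      refine (norm_sub_le _ _).trans ?_
      rw [norm_mul, Complex.norm_real, Real.norm_of_nonneg (by positivity)]
      calc _ ≤ x ^ 2 + 1 / t * (t * x) ^ 2 := by gcongr
        _ = (1 + t) * x ^ 2 := by field_simp
        _ ≤ (2 + 2 / t) * x ^ 2 := by
          gcongr
          · norm_num
          · exact ht1.trans ((le_div_iff₀ htpos).2 (by linarith))
    · have hx2 : 1 ≤ x ^ 2 := by rw [← sq_abs]; exact one_le_pow₀ hx.le
      rw [min_eq_left hx2]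
      refine (norm_sub_le _ _).trans ?_
      rw [norm_mul, Complex.norm_real, Real.norm_of_nonneg (by positivity)]
      calc _ ≤ 2 + 1 / t * 2 := by
            gcongr
            · exact h2 1
            · exact h2 t
        _ = (2 + 2 / t) * 1 := by ring
  refine ⟨(2 + 2 / t) * C + 1 / t, fun n => ?_⟩
  have hn : (0 : ℝ) < n + 1 := by positivity
  have hint : ∀ s : ℝ, Integrable (fun x : ℝ => Complex.exp (s * x * Complex.I) - 1) (Q n) := by
    intro s
    refine (Integrable.of_bound (C := 1) (by fun_prop) (ae_of_all _ fun x => ?_)).sub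
      (integrable_const _)
    rw [hE]
  have hcf : ∀ s : ℝ, charFun (Q n) s - 1 = ∫ x : ℝ, (Complex.exp (s * x * Complex.I) - 1) ∂(Q n) := by
    intro s
    rw [integral_sub _ (integrable_const _), charFun_apply_real]
    · simp
    · refine Integrable.of_bound (C := 1) (by fun_prop) (ae_of_all _ fun x => ?_)
      rw [hE]
  have hi0 : Integrable (fun x : ℝ => min 1 (x ^ 2)) (Q n) := by
    refine Integrable.of_bound (C := 1) (by fun_prop) (ae_of_all _ fun x => ?_)
    rw [Real.norm_of_nonneg (by positivity)]
    exact min_le_left _ _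
  have h6 : ‖(charFun (Q n) 1 - 1) - (1 / t : ℝ) * (charFun (Q n) t - 1)‖ ≤
      (2 + 2 / t) * ∫ x, min 1 (x ^ 2) ∂(Q n) := by
    rw [hcf 1, hcf t, ← integral_const_mul, ← integral_sub (hint 1) ((hint t).const_mul _),
      ← integral_const_mul]
    exact norm_integral_le_of_norm_le (hi0.const_mul _) (ae_of_all _ hpt)
  have h7 : ‖charFun (Q n) 1 - 1‖ ≤ (2 + 2 / t) * (∫ x, min 1 (x ^ 2) ∂(Q n))
      + 1 / t * ‖1 - charFun (Q n) t‖ := by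
    have h8 := norm_add_le ((charFun (Q n) 1 - 1) - (1 / t : ℝ) * (charFun (Q n) t - 1))
      ((1 / t : ℝ) * (charFun (Q n) t - 1))
    rw [sub_add_cancel, norm_mul, Complex.norm_real, Real.norm_of_nonneg (by positivity),
      norm_sub_rev (charFun (Q n) t)] at h8
    linarith
  have h5 := hb n t (by rw [abs_of_pos htpos]; exact min_le_left _ _)
  calc (n + 1 : ℝ) * ‖charFun (Q n) 1 - 1‖
      ≤ (n + 1) * ((2 + 2 / t) * (∫ x, min 1 (x ^ 2) ∂(Q n)) + 1 / t * ‖1 - charFun (Q n) t‖) := by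
        gcongr
    _ = (2 + 2 / t) * ((n + 1) * ∫ x, min 1 (x ^ 2) ∂(Q n))
        + 1 / t * ((n + 1) * ‖1 - charFun (Q n) t‖) := by ring
    _ ≤ (2 + 2 / t) * C + 1 / t * 1 := by
        gcongr
        exact hC n
    _ = (2 + 2 / t) * C + 1 / t := by ring

theorem tendsto_one_add_pow_succ_exp {l : Filter ℕ} (hl : l ≤ atTop) {g : ℕ → ℂ} {z : ℂ}
    (hg : Tendsto (fun n : ℕ => (n + 1 : ℂ) * g n) l (𝓝 z)) :
    Tendsto (fun n => (1 + g n) ^ (n + 1)) l (𝓝 (Complex.exp z)) := by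
  have hinv : Tendsto (fun n : ℕ => ((n : ℂ) + 1)⁻¹) l (𝓝 0) := by
    have := (tendsto_one_div_add_atTop_nhds_zero_nat (𝕜 := ℂ)).mono_left hl
    simpa using this
  have hne : ∀ n : ℕ, (n : ℂ) + 1 ≠ 0 := fun n => by exact_mod_cast n.succ_ne_zero
  have hg0 : Tendsto g l (𝓝 0) := by
    have := hinv.mul hg
    simpa [inv_mul_cancel_left₀ (hne _)] using this
  have hsmall : ∀ᶠ n in l, ‖g n‖ < 1 / 2 :=
    (tendsto_norm_zero.comp hg0).eventually_lt_const (by norm_num)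
  have hlog : Tendsto (fun n : ℕ => (n + 1 : ℂ) * Complex.log (1 + g n)) l (𝓝 z) := by
    -- Since `log (1 + g) - g = O(|g|²)`, the error is `|(n+1) g| · |g|`, a bounded factor times a
    -- null one.
    have hd : Tendsto (fun n : ℕ => (n + 1 : ℂ) * (Complex.log (1 + g n) - g n)) l (𝓝 0) := by
      have hb : Tendsto (fun n : ℕ => ‖(n + 1 : ℂ) * g n‖ * ‖g n‖) l (𝓝 0) := by
        simpa using hg.norm.mul hg0.norm
      refine squeeze_zero_norm' ?_ hb
      filter_upwards [hsmall] with n hn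
      have h1 := Complex.norm_log_one_add_sub_self_le (z := g n) (by linarith)
      have h2 : (1 - ‖g n‖)⁻¹ ≤ 2 := by
        rw [inv_le_comm₀ (by linarith) (by norm_num)]
        linarith
      rw [norm_mul, norm_mul, mul_assoc]
      gcongr
      refine h1.trans ?_
      nlinarith [sq_nonneg ‖g n‖]
    have := hd.add hg
    simp only [zero_add] at this
    refine this.congr fun n => by ring
  refine ((Complex.continuous_exp.tendsto z).comp hlog).congr' ?_
  filter_upwards [hsmall] with n hn
  have hne1 : 1 + g n ≠ 0 := by
    intro h0
    have : g n = -1 := by linear_combination h0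
    rw [this] at hn
    norm_num at hn
  simp only [Function.comp]
  rw [show ((n : ℂ) + 1) = ((n + 1 : ℕ) : ℂ) by push_cast; rfl, Complex.exp_nat_mul,
    Complex.exp_log hne1]

end RootEstimates

/-! ### Compactness and limiting Lévy measures -/

section LevyLimit

open Filter Topology
open scoped NNReal

theorem min_one_cube_le {E : Type*} [NormedAddCommGroup E] (x : E) : min 1 (‖x‖ ^ 3) ≤ ‖x‖ * min 1 (‖x‖ ^ 2) := by
  rcases le_total ‖x‖ 1 with h | h
  · rw [min_eq_right (pow_le_one₀ (n := 2) (norm_nonneg _) h)]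
    exact (min_le_right _ _).trans_eq (by ring)
  · rw [min_eq_left (one_le_pow₀ (n := 2) h), mul_one]
    exact (min_le_left _ _).trans h

theorem min_one_cube_le_min_one_sq {E : Type*} [NormedAddCommGroup E] (x : E) : min 1 (‖x‖ ^ 3) ≤ min 1 (‖x‖ ^ 2) := by
  rcases le_total ‖x‖ 1 with h | h
  · exact min_le_min_left _ (pow_le_pow_of_le_one (norm_nonneg _) h (by norm_num))
  · rw [min_eq_left (one_le_pow₀ h), min_eq_left (one_le_pow₀ h)]

theorem continuous_div_min_one_sq {E : Type*} [NormedAddCommGroup E] {F : E → ℝ} (hF : Continuous F) {K : ℝ}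
    (hK : ∀ x, |F x| ≤ K * min 1 (‖x‖ ^ 3)) : Continuous fun x => F x / min 1 (‖x‖ ^ 2) := by
  rw [continuous_iff_continuousAt]
  intro x
  rcases eq_or_ne x 0 with rfl | hx
  -- At the origin the quotient is `F 0 / 0 = 0` by convention, which is also its limit there.
  · have hb : ∀ x : E, ‖F x / min 1 (‖x‖ ^ 2)‖ ≤ |K| * ‖x‖ := by
      intro x
      rcases eq_or_ne x 0 with rfl | hx
      · simp
      · have hpos : 0 < min 1 (‖x‖ ^ 2) := lt_min one_pos (pow_pos (norm_pos_iff.2 hx) 2)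
        rw [norm_div, Real.norm_eq_abs, Real.norm_of_nonneg hpos.le, div_le_iff₀ hpos, mul_assoc]
        refine (hK x).trans ?_
        gcongr
        · exact le_abs_self K
        · exact min_one_cube_le x
    have h0 : Tendsto (fun x : E => |K| * ‖x‖) (𝓝 0) (𝓝 0) := by
      have : Continuous fun x : E => |K| * ‖x‖ := by fun_prop
      simpa using this.tendsto 0
    have := squeeze_zero_norm hb h0
    simpa [ContinuousAt] using this
  · refine hF.continuousAt.div (by fun_prop) ?_
    exact (lt_min one_pos (pow_pos (norm_pos_iff.2 hx) 2)).ne'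

variable {E : Type*} [NormedAddCommGroup E] [NormedSpace ℝ E] [FiniteDimensional ℝ E]
  [MeasurableSpace E] [BorelSpace E]

/-- Prokhorov for the finite measures `(n+1) min(1,|x|²) P n`: the moment bound limits their mass,
and the tail bound with `ε = 1/(k+1)` makes them tight. The ultrafilter then converges in the
resulting compact set. -/
theorem exists_tendsto_integral_of_bounded_second_moment (l : Ultrafilter ℕ) {P : ℕ → Measure E}
    [∀ n, IsProbabilityMeasure (P n)] {C : ℝ}
    (hC : ∀ n : ℕ, (n + 1 : ℝ) * ∫ x, min 1 (‖x‖ ^ 2) ∂(P n) ≤ C)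
    (ht : ∀ ε > 0, ∃ R > 0, ∀ n : ℕ, (n + 1 : ℝ) * (P n).real {x | R < ‖x‖} ≤ ε) :
    ∃ η : FiniteMeasure E, ∀ G : E → ℝ, Continuous G → (∃ M, ∀ x, |G x| ≤ M) →
      Tendsto (fun n : ℕ => (n + 1 : ℝ) * ∫ x, min 1 (‖x‖ ^ 2) * G x ∂(P n)) l
        (𝓝 (∫ x, G x ∂(η : Measure E))) := by
  let w : E → ℝ≥0 := fun x => min 1 (‖x‖₊ ^ 2)
  have hw : Measurable w := by fun_prop
  have hw1 : ∀ x, w x ≤ 1 := fun x => min_le_left _ _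
  let f : ℕ → E → ℝ≥0 := fun n x => (n + 1) * w x
  have hf : ∀ n, Measurable (f n) := fun n => by fun_prop
  have hfint : ∀ n, Integrable (fun x => (f n x : ℝ)) (P n) := by
    intro n
    refine Integrable.of_bound (C := n + 1) (by fun_prop) (ae_of_all _ fun x => ?_)
    rw [Real.norm_of_nonneg (by positivity)]
    have : (w x : ℝ) ≤ 1 := hw1 x
    simp only [f]
    push_cast
    nlinarith [(n.cast_nonneg : (0 : ℝ) ≤ n)]
  let m : ℕ → Measure E := fun n => (P n).withDensity fun x => f n x
  have hmass : ∀ n, m n Set.univ ≤ ENNReal.ofReal C := by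
    intro n
    simp only [m]
    rw [withDensity_apply _ MeasurableSet.univ, setLIntegral_univ,
      lintegral_coe_eq_integral _ (hfint n)]
    refine ENNReal.ofReal_le_ofReal (le_trans (le_of_eq ?_) (hC n))
    rw [← integral_const_mul]
    simp [f, w]
  have hfin : ∀ n, IsFiniteMeasure (m n) := fun n => ⟨(hmass n).trans_lt ENNReal.ofReal_lt_top⟩
  let η : ℕ → FiniteMeasure E := fun n => ⟨m n, hfin n⟩
  have hu : Tendsto (fun k : ℕ => (1 / (k + 1) : ℝ≥0)) atTop (𝓝 0) :=
    tendsto_one_div_add_atTop_nhds_zero_nat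
  choose R hRpos hR using fun k : ℕ => ht (1 / (k + 1)) (by positivity)
  have hcomp := isCompact_setOfPred_finiteMeasure_mass_le_compl_isCompact_le (E := E)
    (K := fun k => Metric.closedBall 0 (R k)) C.toNNReal hu (fun k => isCompact_closedBall _ _)
    (Or.inl inferInstance)
  have hmem : ∀ n, η n ∈ {μ : FiniteMeasure E | μ.mass ≤ C.toNNReal ∧
      ∀ k, μ (Metric.closedBall 0 (R k))ᶜ ≤ (1 / (k + 1) : ℝ≥0)} := by
    intro n
    refine ⟨?_, fun k => ?_⟩
    · rw [← ENNReal.coe_le_coe, FiniteMeasure.ennreal_mass]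
      exact hmass n
    · rw [← ENNReal.coe_le_coe, FiniteMeasure.ennreal_coeFn_eq_coeFn_toMeasure]
      have hset : (Metric.closedBall (0 : E) (R k))ᶜ = {x | R k < ‖x‖} := by
        ext x
        simp
      change m n _ ≤ _
      have hms : MeasurableSet {x : E | R k < ‖x‖} := measurableSet_lt (by fun_prop) (by fun_prop)
      rw [hset]
      simp only [m]
      rw [withDensity_apply _ hms]
      calc ∫⁻ x in {x | R k < ‖x‖}, f n x ∂(P n)
          ≤ ∫⁻ x in {x | R k < ‖x‖}, ((n + 1 : ℝ≥0) : ℝ≥0∞) ∂(P n) := by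
            refine lintegral_mono fun x => ENNReal.coe_le_coe.2 ?_
            simp only [f]
            calc (n + 1 : ℝ≥0) * w x ≤ (n + 1) * 1 := by
                  gcongr
                  exact hw1 x
              _ = n + 1 := mul_one _
        _ = ENNReal.ofReal ((n + 1 : ℝ) * (P n).real {x | R k < ‖x‖}) := by
            rw [setLIntegral_const, ENNReal.ofReal_mul (by positivity), ofReal_measureReal]
            congr 1
            rw [← NNReal.coe_natCast, ← NNReal.coe_one, ← NNReal.coe_add, ENNReal.ofReal_coe_nnreal]
        _ ≤ ((1 / (k + 1) : ℝ≥0) : ℝ≥0∞) := by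
            rw [← ENNReal.ofReal_coe_nnreal]
            refine ENNReal.ofReal_le_ofReal ((hR k n).trans (le_of_eq ?_))
            push_cast
            rfl
  obtain ⟨η₀, -, hη₀⟩ := hcomp.ultrafilter_le_nhds (l.map η)
    (le_principal_iff.2 (Filter.mem_map.2 (Filter.univ_mem' hmem)))
  refine ⟨η₀, fun G hG ⟨M, hM⟩ => ?_⟩
  have hlim : Tendsto η l (𝓝 η₀) := hη₀
  rw [FiniteMeasure.tendsto_iff_forall_integral_tendsto] at hlim
  have h1 := hlim (BoundedContinuousFunction.ofNormedAddCommGroup G hG M hM)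
  simp only [BoundedContinuousFunction.coe_ofNormedAddCommGroup] at h1
  refine h1.congr fun n => ?_
  change ∫ x, G x ∂(m n) = _
  simp only [m]
  rw [integral_withDensity_eq_integral_smul (hf n), ← integral_const_mul]
  refine integral_congr_ae (ae_of_all _ fun x => ?_)
  simp [f, w, NNReal.smul_def, mul_assoc]

/-- `ν` is a Lévy measure without mass at the origin, and the measures `(n + 1) P n` converge to it
along `l` when tested against continuous functions of order `min (1, |x|³)`. -/
structure IsLevyLimit (l : Filter ℕ) (P : ℕ → Measure E) (ν : Measure E) : Prop where
  measure_zero : ν {0} = 0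
  lintegral_lt_top : ∫⁻ x, min 1 (‖x‖ₑ ^ 2) ∂ν < ∞
  tendsto : ∀ F : E → ℝ, Continuous F → (∃ K, ∀ x, |F x| ≤ K * min 1 (‖x‖ ^ 3)) →
    Tendsto (fun n : ℕ => (n + 1 : ℝ) * ∫ x, F x ∂(P n)) l (𝓝 (∫ x, F x ∂ν))

/-- The weak limit `η` of the weighted measures is divided by the weight off the origin. Its atom at
the origin is discarded; this is harmless for third-order tests, because their quotient by the
weight is continuous and vanishes there. -/
theorem exists_isLevyLimit (l : Ultrafilter ℕ) {P : ℕ → Measure E}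
    [∀ n, IsProbabilityMeasure (P n)] {C : ℝ}
    (hC : ∀ n : ℕ, (n + 1 : ℝ) * ∫ x, min 1 (‖x‖ ^ 2) ∂(P n) ≤ C)
    (ht : ∀ ε > 0, ∃ R > 0, ∀ n : ℕ, (n + 1 : ℝ) * (P n).real {x | R < ‖x‖} ≤ ε) :
    ∃ ν : Measure E, IsLevyLimit l P ν := by
  obtain ⟨η, hη⟩ := exists_tendsto_integral_of_bounded_second_moment l hC ht
  let w : E → ℝ≥0 := fun x => min 1 (‖x‖₊ ^ 2)
  have hw : Measurable w := by fun_prop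
  have hwpos : ∀ x, x ≠ 0 → 0 < w x := fun x hx => lt_min one_pos (pow_pos (nnnorm_pos.2 hx) 2)
  have hms : MeasurableSet ({0}ᶜ : Set E) := (measurableSet_singleton 0).compl
  refine ⟨((η : Measure E).restrict {0}ᶜ).withDensity fun x => ((w x)⁻¹ : ℝ≥0), ?_, ?_, ?_⟩
  · refine withDensity_absolutelyContinuous _ _ ?_
    rw [Measure.restrict_apply (measurableSet_singleton 0)]
    simp
  · rw [lintegral_withDensity_eq_lintegral_mul _ (by fun_prop) (by fun_prop)]
    refine lt_of_le_of_lt (lintegral_mono (g := fun _ => 1) fun x => ?_) ?_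
    · have h1 : min 1 (‖x‖ₑ ^ 2) = (w x : ℝ≥0∞) := by simp [w, enorm_eq_nnnorm]
      simp only [Pi.mul_apply, h1]
      rw [← ENNReal.coe_mul]
      exact_mod_cast inv_mul_le_one
    · rw [lintegral_one]
      exact measure_lt_top _ _
  · rintro F hF ⟨K, hK⟩
    have hcont := continuous_div_min_one_sq hF hK
    have hF0 : F 0 = 0 := by simpa using hK 0
    have hpos : ∀ x : E, x ≠ 0 → 0 < min 1 (‖x‖ ^ 2) := fun x hx =>
      lt_min one_pos (pow_pos (norm_pos_iff.2 hx) 2)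
    have hb : ∀ x, |F x / min 1 (‖x‖ ^ 2)| ≤ |K| := by
      intro x
      rcases eq_or_ne x 0 with rfl | hx
      · simp
      · rw [abs_div, abs_of_pos (hpos x hx), div_le_iff₀ (hpos x hx)]
        refine (hK x).trans ?_
        exact mul_le_mul (le_abs_self K) (min_one_cube_le_min_one_sq x) (by positivity) (abs_nonneg K)
    have h1 := hη _ hcont ⟨_, hb⟩
    have e1 : ∀ x : E, min 1 (‖x‖ ^ 2) * (F x / min 1 (‖x‖ ^ 2)) = F x := by
      intro x
      rcases eq_or_ne x 0 with rfl | hx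
      · simp [hF0]
      · exact mul_div_cancel₀ _ (hpos x hx).ne'
    simp only [e1] at h1
    convert h1 using 2
    rw [integral_withDensity_eq_integral_smul (by fun_prop),
      ← integral_add_compl (measurableSet_singleton (0 : E))
        (Integrable.of_bound (C := |K|) hcont.aestronglyMeasurable (ae_of_all _ hb)),
      setIntegral_congr_fun (g := fun _ => (0 : ℝ)) (measurableSet_singleton (0 : E))
        (fun x hx => by simp [Set.mem_singleton_iff.1 hx])]
    simp only [integral_zero, zero_add]
    refine integral_congr_ae (ae_of_all _ fun x => ?_)
    simp [w, NNReal.smul_def, div_eq_inv_mul]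

end LevyLimit

/-! ### Lévy limits under linear maps -/

section LevyLimitMap

open Filter Topology
open scoped NNReal

theorem min_one_pow_norm_map_le {E E' : Type*} [NormedAddCommGroup E] [NormedSpace ℝ E]
    [NormedAddCommGroup E'] [NormedSpace ℝ E'] (T : E →L[ℝ] E') (x : E) (k : ℕ) :
    min 1 (‖T x‖ ^ k) ≤ max 1 ‖T‖ ^ k * min 1 (‖x‖ ^ k) := by
  have h1 : 1 ≤ max 1 ‖T‖ ^ k := one_le_pow₀ (le_max_left _ _)
  rcases le_total (‖x‖ ^ k) 1 with h | h
  · rw [min_eq_right h, ← mul_pow]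
    refine (min_le_right _ _).trans (pow_le_pow_left₀ (norm_nonneg _) ?_ k)
    exact (T.le_opNorm x).trans (by gcongr; exact le_max_right _ _)
  · rw [min_eq_left h, mul_one]
    exact (min_le_left _ _).trans h1

variable {E E' : Type*} [NormedAddCommGroup E] [NormedSpace ℝ E] [FiniteDimensional ℝ E]
  [MeasurableSpace E] [BorelSpace E] [NormedAddCommGroup E'] [NormedSpace ℝ E']
  [FiniteDimensional ℝ E'] [MeasurableSpace E'] [BorelSpace E']

theorem integrable_of_abs_le_min_one_sq {ν : Measure E} (hν : ∫⁻ x, min 1 (‖x‖ₑ ^ 2) ∂ν < ∞)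
    {F : E → ℝ} (hF : Measurable F) {K : ℝ} (hK : ∀ x, |F x| ≤ K * min 1 (‖x‖ ^ 2)) :
    Integrable F ν := by
  have h1 : Integrable (fun x : E => min 1 (‖x‖ ^ 2)) ν := by
    refine ⟨by fun_prop, ?_⟩
    rw [hasFiniteIntegral_iff_enorm]
    refine lt_of_le_of_lt (lintegral_mono fun x => le_of_eq ?_) hν
    have : (min 1 (‖x‖ ^ 2) : ℝ) = ((min 1 (‖x‖₊ ^ 2) : ℝ≥0) : ℝ) := by simp
    rw [this, ← ofReal_norm, NNReal.norm_eq, ENNReal.ofReal_coe_nnreal]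
    simp [enorm_eq_nnnorm]
  exact (h1.const_mul K).mono' hF.aestronglyMeasurable (ae_of_all _ hK)

namespace IsLevyLimit

variable {l : Filter ℕ} {P : ℕ → Measure E} {P' : ℕ → Measure E'} {ν : Measure E} {ν' : Measure E'}

omit [FiniteDimensional ℝ E] [FiniteDimensional ℝ E'] in
theorem integral_comp_eq [l.NeBot] (h : IsLevyLimit l P ν) (h' : IsLevyLimit l P' ν')
    (T : E →L[ℝ] E') (hP : ∀ n, P' n = (P n).map T) {F : E' → ℝ} (hF : Continuous F) {K : ℝ}
    (hK : ∀ x, |F x| ≤ K * min 1 (‖x‖ ^ 3)) : ∫ x, F x ∂ν' = ∫ x, F (T x) ∂ν := by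
  refine tendsto_nhds_unique (h'.tendsto F hF ⟨K, hK⟩) ?_
  have h1 := h.tendsto (fun x => F (T x)) (by fun_prop)
    ⟨|K| * max 1 ‖T‖ ^ 3, fun x => (hK (T x)).trans ?_⟩
  · refine h1.congr fun n => ?_
    rw [hP, integral_map (by fun_prop) hF.aestronglyMeasurable]
  · rw [mul_assoc]
    gcongr
    · exact le_abs_self K
    · exact min_one_pow_norm_map_le T x 3

/-- Multiplied by `min(1,|x|³)`, both measures become finite and have the same integrals against
bounded continuous functions, by uniqueness of limits; the weight is then inverted off the origin.
Sets containing the origin are excluded because `T` may collapse mass of its kernel there. -/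
theorem measure_eq_measure_preimage [l.NeBot] (h : IsLevyLimit l P ν) (h' : IsLevyLimit l P' ν')
    (T : E →L[ℝ] E') (hP : ∀ n, P' n = (P n).map T) {B : Set E'} (hB : MeasurableSet B)
    (h0 : (0 : E') ∉ B) : ν' B = ν (T ⁻¹' B) := by
  let w : E' → ℝ≥0 := fun x => min 1 (‖x‖₊ ^ 3)
  have hw : Measurable w := by fun_prop
  have hwr : ∀ x, (w x : ℝ) = min 1 (‖x‖ ^ 3) := fun x => by simp [w]
  have hw0 : w 0 = 0 := by simp [w]
  have hms : MeasurableSet ({0}ᶜ : Set E') := (measurableSet_singleton 0).compl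
  have hT : Measurable T := T.continuous.measurable
  have hfin : ∀ (m : Measure E'), Integrable (fun x => (w x : ℝ)) m →
      IsFiniteMeasure ((m.restrict {0}ᶜ).withDensity fun x => w x) := by
    intro m hm
    refine isFiniteMeasure_withDensity ?_
    rw [lintegral_coe_eq_integral _ hm.integrableOn]
    exact ENNReal.ofReal_ne_top
  have hi' : Integrable (fun x => (w x : ℝ)) ν' := by
    refine integrable_of_abs_le_min_one_sq h'.lintegral_lt_top (by fun_prop) (K := 1) fun x => ?_
    rw [hwr, abs_of_nonneg (by positivity), one_mul]
    exact min_one_cube_le_min_one_sq x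
  have hi : Integrable (fun x => (w x : ℝ)) (ν.map T) := by
    rw [integrable_map_measure (by fun_prop) hT.aemeasurable]
    refine integrable_of_abs_le_min_one_sq h.lintegral_lt_top (by fun_prop)
      (K := max 1 ‖T‖ ^ 3) fun x => ?_
    simp only [Function.comp]
    rw [hwr, abs_of_nonneg (by positivity)]
    refine (min_one_pow_norm_map_le T x 3).trans ?_
    exact mul_le_mul_of_nonneg_left (min_one_cube_le_min_one_sq x) (by positivity)
  have := hfin _ hi
  have := hfin _ hi'
  have hint : ∀ (m : Measure E') (G : E' → ℝ),
      ∫ x, G x ∂((m.restrict {0}ᶜ).withDensity fun x => w x) = ∫ x, (w x : ℝ) * G x ∂m := by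
    intro m G
    rw [integral_withDensity_eq_integral_smul hw]
    simp only [NNReal.smul_def, smul_eq_mul]
    refine setIntegral_eq_integral_of_forall_compl_eq_zero fun x hx => ?_
    simp [Set.notMem_compl_iff.1 hx |> Set.mem_singleton_iff.1, hw0]
  have heq : (ν'.restrict {0}ᶜ).withDensity (fun x => (w x : ℝ≥0∞))
      = ((ν.map T).restrict {0}ᶜ).withDensity (fun x => (w x : ℝ≥0∞)) := by
    refine ext_of_forall_integral_eq_of_IsFiniteMeasure fun G => ?_
    rw [hint, hint, integral_map hT.aemeasurable (by fun_prop)]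
    refine h.integral_comp_eq h' T hP (F := fun x => (w x : ℝ) * G x) (by fun_prop) (K := ‖G‖)
      fun x => ?_
    rw [abs_mul, abs_of_nonneg (NNReal.coe_nonneg _), hwr, mul_comm]
    gcongr
    exact G.norm_coe_le_norm x
  have hinv : ∀ m : Measure E', ((m.restrict {0}ᶜ).withDensity fun x => (w x : ℝ≥0∞)).withDensity
      (fun x => (w x : ℝ≥0∞)⁻¹) = m.restrict {0}ᶜ := by
    intro m
    refine withDensity_inv_same (by fun_prop) ?_ (ae_of_all _ fun x => ENNReal.coe_ne_top)
    filter_upwards [ae_restrict_mem hms] with x hx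
    have : 0 < w x := lt_min one_pos (pow_pos (nnnorm_pos.2 hx) 3)
    exact ENNReal.coe_ne_zero.2 this.ne'
  have hr : ν'.restrict {0}ᶜ = (ν.map T).restrict {0}ᶜ := by
    rw [← hinv ν', heq, hinv]
  have hsub : B ⊆ {0}ᶜ := fun x hx hx0 => h0 (Set.mem_singleton_iff.1 hx0 ▸ hx)
  rw [← Measure.restrict_eq_self ν' hsub, hr, Measure.restrict_eq_self _ hsub,
    Measure.map_apply hT hB]

/-- Test against `min(1, dist(x, V)³)`: it is of third order because `0 ∈ V`, it integrates to zero
under each `P n`, and its zero set is the closed subspace `V`. -/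
theorem measure_compl_submodule_eq_zero [l.NeBot] (h : IsLevyLimit l P ν) (V : Submodule ℝ E)
    (hV : ∀ n, P n (V : Set E)ᶜ = 0) : ν (V : Set E)ᶜ = 0 := by
  let F : E → ℝ := fun x => min 1 (Metric.infDist x (V : Set E) ^ 3)
  have hF : Continuous F := by
    have := Metric.continuous_infDist_pt (V : Set E)
    fun_prop
  have hVc : IsClosed (V : Set E) := V.closed_of_finiteDimensional
  have hle : ∀ x, |F x| ≤ 1 * min 1 (‖x‖ ^ 3) := by
    intro x
    have hpos : 0 ≤ Metric.infDist x (V : Set E) := Metric.infDist_nonneg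
    rw [abs_of_nonneg (by positivity), one_mul]
    refine min_le_min_left _ (pow_le_pow_left₀ hpos ?_ 3)
    simpa using Metric.infDist_le_dist_of_mem (x := x) V.zero_mem
  have hlim := h.tendsto F hF ⟨1, hle⟩
  have hzero : ∀ n, ∫ x, F x ∂(P n) = 0 := by
    intro n
    refine integral_eq_zero_of_ae ?_
    filter_upwards [compl_mem_ae_iff.2 (hV n)] with x hx
    rw [compl_compl] at hx
    simp [F, Metric.infDist_zero_of_mem hx]
  simp only [hzero, mul_zero] at hlim
  have hint : ∫ x, F x ∂ν = 0 := tendsto_nhds_unique hlim tendsto_const_nhds |>.symm ▸ rfl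
  have hi : Integrable F ν := by
    refine integrable_of_abs_le_min_one_sq h.lintegral_lt_top hF.measurable (K := 1) fun x =>
      (hle x).trans ?_
    exact mul_le_mul_of_nonneg_left (min_one_cube_le_min_one_sq x) (by positivity)
  have hnn : 0 ≤ F := fun x => by
    have : 0 ≤ Metric.infDist x (V : Set E) := Metric.infDist_nonneg
    exact le_min zero_le_one (by positivity)
  have hae := (integral_eq_zero_iff_of_nonneg hnn hi).1 hint
  rw [← mem_ae_iff]
  filter_upwards [hae] with x hx
  rw [hVc.mem_iff_infDist_zero ⟨0, V.zero_mem⟩]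
  by_contra hne
  have hpos : 0 < Metric.infDist x (V : Set E) := lt_of_le_of_ne Metric.infDist_nonneg (Ne.symm hne)
  exact (lt_min one_pos (pow_pos hpos 3)).ne' hx

end IsLevyLimit

end LevyLimitMap

/-! ### Finite-dimensional images and convolution -/

section CylindricalImages

variable {U : Type*} [NormedAddCommGroup U] [NormedSpace ℝ U]

theorem preimage_mem_cylSets (a : StrongDual ℝ U) {B : Set ℝ} (hB : MeasurableSet B) :
    a ⁻¹' B ∈ cylSets (Set.univ : Set (StrongDual ℝ U)) :=
  ⟨1, fun _ => a, (fun x => x 0) ⁻¹' B, fun _ => Set.mem_univ _,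
    (by fun_prop : Measurable fun x : EuclideanSpace ℝ (Fin 1) => x 0) hB, rfl⟩

/-- The continuous linear map with coordinates `c`. -/
noncomputable def coordMap {E : Type*} [NormedAddCommGroup E] [NormedSpace ℝ E] {m : ℕ}
    (c : Fin m → StrongDual ℝ E) : E →L[ℝ] EuclideanSpace ℝ (Fin m) :=
  (EuclideanSpace.equiv (Fin m) ℝ).symm.toContinuousLinearMap ∘L ContinuousLinearMap.pi c

theorem coordMap_eq_cylProj {m : ℕ} (a : Fin m → StrongDual ℝ U) (u : U) :
    coordMap a u = cylProj a u := rfl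

namespace CylindricalMeasure

variable (μ : CylindricalMeasure U)

theorem image₁_apply (a : StrongDual ℝ U) {B : Set ℝ} (hB : MeasurableSet B) :
    μ.image₁ a B = μ.toFun ⟨a ⁻¹' B, preimage_mem_cylSets a hB⟩ := by
  have h := measurable_apply_cylSigma (Set.mem_singleton a)
  rw [image₁, @Measure.map_apply _ _ (cylSigma {a}) _ _ _ h _ hB]
  exact μ.toMeasure_apply (Set.finite_singleton a) ⟨a ⁻¹' B, preimage_mem_cylSets a hB⟩ (h hB)

theorem image_eq_image {n m : ℕ} (a : Fin n → StrongDual ℝ U) (b : Fin m → StrongDual ℝ U)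
    {B : Set (EuclideanSpace ℝ (Fin n))} {B' : Set (EuclideanSpace ℝ (Fin m))}
    (hB : MeasurableSet B) (hB' : MeasurableSet B') (h : cylProj a ⁻¹' B = cylProj b ⁻¹' B') :
    μ.image a B = μ.image b B' := by
  rw [μ.image_apply a hB, μ.image_apply b hB']
  congr 1
  exact Subtype.ext h

theorem image_eq_map {n m : ℕ} (a : Fin n → StrongDual ℝ U) (b : Fin m → StrongDual ℝ U)
    {T : EuclideanSpace ℝ (Fin n) → EuclideanSpace ℝ (Fin m)} (hT : Measurable T)
    (h : ∀ u, T (cylProj a u) = cylProj b u) : μ.image b = (μ.image a).map T := by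
  ext B hB
  rw [Measure.map_apply hT hB]
  refine μ.image_eq_image b a hB (hT hB) ?_
  ext u
  simp [h]

theorem image₁_eq_map {n : ℕ} (a : Fin n → StrongDual ℝ U) (b : StrongDual ℝ U)
    {f : EuclideanSpace ℝ (Fin n) → ℝ} (hf : Measurable f) (h : ∀ u, f (cylProj a u) = b u) :
    μ.image₁ b = (μ.image a).map f := by
  ext B hB
  rw [Measure.map_apply hf hB, μ.image_apply a (hf hB), μ.image₁_apply b hB]
  congr 1
  refine Subtype.ext ?_
  ext u
  simp [h]

/-- The complement of the range has empty preimage. This is needed because linearly dependent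
functionals give a proper subspace, and a cylindrical set determines its base only on that subspace.
-/
theorem image_compl_range {n : ℕ} (a : Fin n → StrongDual ℝ U) :
    μ.image a (LinearMap.range (coordMap a).toLinearMap : Set (EuclideanSpace ℝ (Fin n)))ᶜ = 0 := by
  have hm : MeasurableSet
      (LinearMap.range (coordMap a).toLinearMap : Set (EuclideanSpace ℝ (Fin n)))ᶜ :=
    (LinearMap.range (coordMap a).toLinearMap).closed_of_finiteDimensional.measurableSet.compl
  rw [μ.image_eq_image a a hm MeasurableSet.empty, measure_empty]
  ext u
  simp only [Set.preimage_compl, Set.mem_compl_iff, Set.mem_preimage, Set.preimage_empty,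
    Set.mem_empty_iff_false, iff_false, not_not]
  exact ⟨u, coordMap_eq_cylProj a u⟩

theorem charFn_eq_charFun_image₁ (a : StrongDual ℝ U) : μ.charFn a = charFun (μ.image₁ a) 1 := by
  have h := measurable_apply_cylSigma (Set.mem_singleton a)
  let _ := cylSigma ({a} : Set (StrongDual ℝ U))
  rw [charFun_apply_real, image₁, integral_map h.aemeasurable (by fun_prop), charFn]
  congr 1 with u
  congr 1
  push_cast
  ring

end CylindricalMeasure

namespace CylindricalProbabilityMeasure

theorem isProbabilityMeasure_image (μ : CylindricalProbabilityMeasure U) {n : ℕ}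
    (a : Fin n → StrongDual ℝ U) : IsProbabilityMeasure (μ.1.image a) := by
  refine ⟨?_⟩
  rw [μ.1.image_apply a MeasurableSet.univ]
  exact μ.2

theorem isProbabilityMeasure_image₁ (μ : CylindricalProbabilityMeasure U) (a : StrongDual ℝ U) :
    IsProbabilityMeasure (μ.1.image₁ a) := by
  refine ⟨?_⟩
  rw [μ.1.image₁_apply a MeasurableSet.univ]
  exact μ.2

theorem toMeasure_conv (μ₁ μ₂ : CylindricalProbabilityMeasure U) {Γ : Set (StrongDual ℝ U)}
    (hΓ : Γ.Finite) : (conv μ₁ μ₂).1.toMeasure Γ hΓ = convOn μ₁ μ₂ Γ hΓ := by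
  refine @Measure.ext U (cylSigma Γ) _ _ fun S hS => ?_
  have hS' : S ∈ cylSets (Set.univ : Set (StrongDual ℝ U)) :=
    cylSets_mono (Set.subset_univ _) (mem_cylSets_of_measurableSet hΓ hS)
  refine ((conv μ₁ μ₂).1.toMeasure_apply hΓ ⟨S, hS'⟩ hS).trans ?_
  exact (convOn_congr μ₁ μ₂ hΓ _ hS (exists_finite_measurableSet hS').choose_spec.2).symm

theorem image₁_conv (μ₁ μ₂ : CylindricalProbabilityMeasure U) (a : StrongDual ℝ U) :
    (conv μ₁ μ₂).1.image₁ a = (μ₁.1.image₁ a).conv (μ₂.1.image₁ a) := by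
  have h := measurable_apply_cylSigma (Set.mem_singleton a)
  let _ := cylSigma ({a} : Set (StrongDual ℝ U))
  have := μ₁.isProbabilityMeasure_toMeasure (Set.finite_singleton a)
  have := μ₂.isProbabilityMeasure_toMeasure (Set.finite_singleton a)
  unfold CylindricalMeasure.image₁
  rw [toMeasure_conv, convOn, Measure.map_map h (measurable_add_cylSigma _), Measure.conv,
    Measure.map_prod_map _ _ h h, Measure.map_map (by fun_prop) (h.prodMap h)]
  congr 1
  ext p
  exact map_add a p.1 p.2

theorem image₁_diracZero (a : StrongDual ℝ U) :
    (diracZero : CylindricalProbabilityMeasure U).1.image₁ a = Measure.dirac 0 := by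
  ext B hB
  rw [CylindricalMeasure.image₁_apply _ a hB, Measure.dirac_apply' _ hB]
  change Set.indicator (a ⁻¹' B) 1 0 = _
  by_cases h : (0 : ℝ) ∈ B
  · rw [Set.indicator_of_mem h, Set.indicator_of_mem (by simpa using h)]
    rfl
  · rw [Set.indicator_of_notMem h, Set.indicator_of_notMem (by simpa using h)]
theorem charFun_image₁_convPow (μ : CylindricalProbabilityMeasure U) (n : ℕ) (a : StrongDual ℝ U)
    (t : ℝ) : charFun ((convPow μ n).1.image₁ a) t = charFun (μ.1.image₁ a) t ^ n := by
  induction n with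
  | zero => simp [convPow, image₁_diracZero]
  | succ n ih =>
    have := (convPow μ n).isProbabilityMeasure_image₁ a
    have := μ.isProbabilityMeasure_image₁ a
    rw [convPow, image₁_conv, charFun_conv, ih, pow_succ]

end CylindricalProbabilityMeasure

end CylindricalImages

/-! ### Gluing a consistent family into a cylindrical measure -/

section CylindricalExtension

variable {U : Type*} [NormedAddCommGroup U] [NormedSpace ℝ U]

/-- A consistent family of finite-dimensional measures, each carried by the range of the
corresponding projection, comes from a cylindrical measure of infinite mass at the origin. -/
theorem exists_cylindricalMeasure_of_consistent
    (N : ∀ n : ℕ, (Fin n → StrongDual ℝ U) → Measure (EuclideanSpace ℝ (Fin n)))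
    (hmap : ∀ (n m : ℕ) (a : Fin n → StrongDual ℝ U) (b : Fin m → StrongDual ℝ U)
      (T : EuclideanSpace ℝ (Fin n) →L[ℝ] EuclideanSpace ℝ (Fin m)),
      (∀ u, T (cylProj a u) = cylProj b u) →
      ∀ B : Set (EuclideanSpace ℝ (Fin m)), MeasurableSet B → 0 ∉ B → N m b B = N n a (T ⁻¹' B))
    (hrange : ∀ (n : ℕ) (a : Fin n → StrongDual ℝ U),
      N n a (LinearMap.range (coordMap a).toLinearMap : Set (EuclideanSpace ℝ (Fin n)))ᶜ = 0) :
    ∃ ν : CylindricalMeasure U, ∀ (n : ℕ) (a : Fin n → StrongDual ℝ U)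
      (B : Set (EuclideanSpace ℝ (Fin n))), MeasurableSet B → 0 ∉ B → ν.image a B = N n a B := by
  classical
  have hz : ∀ (n : ℕ) (a : Fin n → StrongDual ℝ U), cylProj a 0 = 0 := fun n a => by
    ext i
    simp [cylProj]
  have hcons : ∀ (n m : ℕ) (a : Fin n → StrongDual ℝ U) (b : Fin m → StrongDual ℝ U)
      (B : Set (EuclideanSpace ℝ (Fin n))) (B' : Set (EuclideanSpace ℝ (Fin m))),
      MeasurableSet B → MeasurableSet B' → 0 ∉ B → 0 ∉ B' →
      cylProj a ⁻¹' B = cylProj b ⁻¹' B' → N n a B = N m b B' := by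
    intro n m a b B B' hB hB' h0 h0' h
    -- Both tuples are coordinate projections of the joint tuple `c`. The two pulled-back bases
    -- agree on the range of `c`, which carries `N c`.
    let c : Fin (n + m) → StrongDual ℝ U := Fin.append a b
    let T : EuclideanSpace ℝ (Fin (n + m)) →L[ℝ] EuclideanSpace ℝ (Fin n) :=
      coordMap fun i => EuclideanSpace.proj (Fin.castAdd m i)
    let T' : EuclideanSpace ℝ (Fin (n + m)) →L[ℝ] EuclideanSpace ℝ (Fin m) :=
      coordMap fun i => EuclideanSpace.proj (Fin.natAdd n i)
    have hT : ∀ u, T (cylProj c u) = cylProj a u := fun u => by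
      ext i
      simp [T, c, coordMap, cylProj]
    have hT' : ∀ u, T' (cylProj c u) = cylProj b u := fun u => by
      ext i
      simp [T', c, coordMap, cylProj]
    rw [hmap _ _ c a T hT B hB h0, hmap _ _ c b T' hT' B' hB' h0']
    refine measure_congr ?_
    filter_upwards [compl_mem_ae_iff.2 (hrange _ c)] with x hx
    rw [compl_compl] at hx
    obtain ⟨u, rfl⟩ := hx
    have hu : cylProj a u ∈ B ↔ cylProj b u ∈ B' := Set.ext_iff.1 h u
    have e : (T (cylProj c u) ∈ B) = (T' (cylProj c u) ∈ B') := by rw [hT, hT']; exact propext hu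
    exact e
  have hrep : ∀ S : cylSets (Set.univ : Set (StrongDual ℝ U)), ∃ (n : ℕ)
      (a : Fin n → StrongDual ℝ U) (B : Set (EuclideanSpace ℝ (Fin n))),
      MeasurableSet B ∧ (S : Set U) = cylProj a ⁻¹' B := by
    rintro ⟨S, n, a, B, -, hB, rfl⟩
    exact ⟨n, a, B, hB, rfl⟩
  choose dim fn base hbase hS using hrep
  -- The value `∞` on sets containing the origin avoids prescribing a consistent mass there.
  let val : cylSets (Set.univ : Set (StrongDual ℝ U)) → ℝ≥0∞ := fun S =>
    if (0 : U) ∈ (S : Set U) then ∞ else N (dim S) (fn S) (base S)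
  have hmem : ∀ (n : ℕ) (a : Fin n → StrongDual ℝ U) (B : Set (EuclideanSpace ℝ (Fin n))),
      (0 : U) ∈ cylProj a ⁻¹' B ↔ (0 : EuclideanSpace ℝ (Fin n)) ∈ B := fun n a B => by
    rw [Set.mem_preimage, hz]
  have hval : ∀ (S : cylSets (Set.univ : Set (StrongDual ℝ U))) (n : ℕ)
      (a : Fin n → StrongDual ℝ U) (B : Set (EuclideanSpace ℝ (Fin n))), MeasurableSet B →
      (S : Set U) = cylProj a ⁻¹' B → 0 ∉ B → val S = N n a B := by
    intro S n a B hB hSB h0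
    have h0S : (0 : U) ∉ (S : Set U) := by rwa [hSB, hmem]
    simp only [val, if_neg h0S]
    refine hcons _ _ _ _ _ _ (hbase S) hB ?_ h0 ((hS S).symm.trans hSB)
    rwa [← hmem _ (fn S), ← hS S]
  have hmeas : ∀ Γ : Set (StrongDual ℝ U), Γ.Finite → ∃ m : @Measure U (cylSigma Γ),
      ∀ S : cylSets (Set.univ : Set (StrongDual ℝ U)), MeasurableSet[cylSigma Γ] (S : Set U) →
        m S = val S := by
    intro Γ hΓ
    obtain ⟨n, a, rfl⟩ : ∃ (n : ℕ) (a : Fin n → StrongDual ℝ U), Γ = Set.range a := by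
      obtain ⟨n, a, -, h⟩ := hΓ.fin_param
      exact ⟨n, a, h.symm⟩
    let _ := cylSigma (Set.range a)
    have hVm : MeasurableSet
        (LinearMap.range (coordMap a).toLinearMap : Set (EuclideanSpace ℝ (Fin n))) :=
      (LinearMap.range (coordMap a).toLinearMap).closed_of_finiteDimensional.measurableSet
    -- A section of the projection over its range, zero elsewhere. It is measurable since the
    -- σ-algebra on `U` is pulled back along the projection, so that only `cylProj a ∘ σ` matters.
    let σ : EuclideanSpace ℝ (Fin n) → U := fun x => if h : ∃ u, cylProj a u = x then h.choose else 0
    have hσ : ∀ x, x ∈ LinearMap.range (coordMap a).toLinearMap → cylProj a (σ x) = x := by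
      rintro x ⟨u, hu⟩
      have h : ∃ u, cylProj a u = x := ⟨u, hu⟩
      simp only [σ, dif_pos h]
      exact h.choose_spec
    have hσ' : ∀ x, x ∉ LinearMap.range (coordMap a).toLinearMap → cylProj a (σ x) = 0 := by
      intro x hx
      have h : ¬ ∃ u, cylProj a u = x := fun ⟨u, hu⟩ => hx ⟨u, hu⟩
      simp only [σ, dif_neg h, hz]
    have hcomp : cylProj a ∘ σ = Set.indicator
        (LinearMap.range (coordMap a).toLinearMap : Set (EuclideanSpace ℝ (Fin n))) id := by
      ext1 x
      by_cases hx : x ∈ (LinearMap.range (coordMap a).toLinearMap : Set (EuclideanSpace ℝ (Fin n)))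
      · rw [Set.indicator_of_mem hx]
        exact hσ x hx
      · rw [Set.indicator_of_notMem hx]
        exact hσ' x hx
    have hσm : Measurable σ := by
      intro S hS
      have hS' : MeasurableSet[MeasurableSpace.comap (cylProj a) inferInstance] S := by
        rw [← cylSigma_range]
        exact hS
      obtain ⟨B, hB, rfl⟩ := hS'
      rw [← Set.preimage_comp, hcomp]
      exact (measurable_id.indicator hVm) hB
    refine ⟨(N n a).map σ + ∞ • Measure.dirac 0, fun S hSm => ?_⟩
    have hS' : MeasurableSet[MeasurableSpace.comap (cylProj a) inferInstance] (S : Set U) := by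
      rw [← cylSigma_range]
      exact hSm
    obtain ⟨B, hB, hSB⟩ := hS'
    rw [Measure.add_apply, Measure.smul_apply, Measure.dirac_apply' _ hSm]
    by_cases h0 : (0 : U) ∈ (S : Set U)
    · simp [val, h0]
    · have h0B : 0 ∉ B := by rwa [← hmem n a, hSB]
      rw [Set.indicator_of_notMem h0, smul_zero, add_zero, hval S n a B hB hSB.symm h0B,
        Measure.map_apply hσm hSm, ← hSB]
      refine measure_congr ?_
      filter_upwards [compl_mem_ae_iff.2 (hrange n a)] with x hx
      rw [compl_compl] at hx
      have e : (cylProj a (σ x) ∈ B) = (x ∈ B) := by rw [hσ x hx]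
      exact e
  refine ⟨⟨val, hmeas⟩, fun n a B hB h0 => ?_⟩
  rw [CylindricalMeasure.image_apply _ a hB]
  exact hval _ n a B hB rfl h0

end CylindricalExtension

/-! ### The cylindrical Lévy measure of the roots -/

section RootLevyLimit

open Filter Topology

variable {U : Type*} [NormedAddCommGroup U] [NormedSpace ℝ U]

open CylindricalProbabilityMeasure

theorem min_one_sum_le_sum_min_one {ι : Type*} (t : Finset ι) {y : ι → ℝ} (hy : ∀ i, 0 ≤ y i) :
    min 1 (∑ i ∈ t, y i) ≤ ∑ i ∈ t, min 1 (y i) := by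
  classical
  induction t using Finset.induction_on with
  | empty => simp
  | insert i t hi ih =>
    rw [Finset.sum_insert hi, Finset.sum_insert hi]
    have h1 : 0 ≤ ∑ j ∈ t, y j := Finset.sum_nonneg fun j _ => hy j
    have h2 : 0 ≤ min 1 (∑ j ∈ t, y j) := le_min zero_le_one h1
    have h3 := hy i
    refine le_trans ?_ (add_le_add_right ih _)
    rcases min_cases 1 (y i) with h | h <;> rcases min_cases 1 (∑ j ∈ t, y j) with h' | h' <;>
      rcases min_cases 1 (y i + ∑ j ∈ t, y j) with h'' | h'' <;> linarith

/-- Both hypotheses of the compactness result reduce to coordinates: `min(1, ·)` is subadditive on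
nonnegative sums, and a large vector has a large coordinate. -/
theorem exists_isLevyLimit_image (l : Ultrafilter ℕ) {μ : CylindricalProbabilityMeasure U}
    {ρ : ℕ → CylindricalProbabilityMeasure U}
    (h : ∀ (a : StrongDual ℝ U) n t,
      charFun ((ρ n).1.image₁ a) t ^ (n + 1) = charFun (μ.1.image₁ a) t)
    {d : ℕ} (a : Fin d → StrongDual ℝ U) :
    ∃ ν, IsLevyLimit l (fun n => (ρ n).1.image a) ν := by
  have hμ := fun b => μ.isProbabilityMeasure_image₁ b
  have hρ := fun n b => (ρ n).isProbabilityMeasure_image₁ b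
  have hρa := fun n => (ρ n).isProbabilityMeasure_image a
  have hmap : ∀ n i, (ρ n).1.image₁ (a i) = ((ρ n).1.image a).map (fun x => x i) := fun n i =>
    (ρ n).1.image₁_eq_map a (a i) (by fun_prop) fun u => rfl
  have h2 := fun i => exists_forall_integral_min_one_sq_root_le (h (a i))
  choose C hC using h2
  refine exists_isLevyLimit l (C := ∑ i, C i) (fun n => ?_) fun ε hε => ?_
  · have hint : ∀ i, Integrable (fun x : EuclideanSpace ℝ (Fin d) => min 1 (x i ^ 2))
        ((ρ n).1.image a) := fun i => by
      refine Integrable.of_bound (C := 1) (by fun_prop) (ae_of_all _ fun x => ?_)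
      rw [Real.norm_of_nonneg (by positivity)]
      exact min_le_left _ _
    have h3 : ∫ x, min 1 (‖x‖ ^ 2) ∂((ρ n).1.image a)
        ≤ ∑ i, ∫ x, min 1 (x i ^ 2) ∂((ρ n).1.image a) := by
      rw [← integral_finsetSum _ fun i _ => hint i]
      refine integral_mono_of_nonneg (ae_of_all _ fun x => by positivity)
        (integrable_finsetSum _ fun i _ => hint i) (ae_of_all _ fun x => ?_)
      simp only [EuclideanSpace.real_norm_sq_eq]
      exact min_one_sum_le_sum_min_one _ fun i => sq_nonneg _
    calc (n + 1 : ℝ) * ∫ x, min 1 (‖x‖ ^ 2) ∂((ρ n).1.image a)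
        ≤ (n + 1) * ∑ i, ∫ x, min 1 (x i ^ 2) ∂((ρ n).1.image a) := by gcongr
      _ = ∑ i, (n + 1) * ∫ x, min 1 (x ^ 2) ∂((ρ n).1.image₁ (a i)) := by
          rw [Finset.mul_sum]
          refine Finset.sum_congr rfl fun i _ => ?_
          rw [hmap, integral_map (by fun_prop) (by fun_prop)]
      _ ≤ ∑ i, C i := Finset.sum_le_sum fun i _ => hC i n
  · have h4 := fun i => exists_forall_measureReal_root_abs_gt_le (h (a i))
      -- Dividing by `d + 1` rather than `d`, and adding 1 to the radius below, also covers `d = 0`.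
      (show 0 < ε / (d + 1) by positivity)
    choose R hR htail using h4
    refine ⟨Real.sqrt (∑ i, R i ^ 2) + 1, by positivity, fun n => ?_⟩
    have hsub : {x : EuclideanSpace ℝ (Fin d) | Real.sqrt (∑ i, R i ^ 2) + 1 < ‖x‖}
        ⊆ ⋃ i, {x | R i < |x i|} := by
      intro x hx
      by_contra hcon
      simp only [Set.mem_iUnion, Set.mem_ofPred_eq, not_exists, not_lt] at hcon hx
      have : ‖x‖ ≤ Real.sqrt (∑ i, R i ^ 2) := by
        rw [EuclideanSpace.norm_eq]
        refine Real.sqrt_le_sqrt (Finset.sum_le_sum fun i _ => ?_)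
        exact pow_le_pow_left₀ (norm_nonneg _) (hcon i) 2
      linarith
    calc (n + 1 : ℝ) * ((ρ n).1.image a).real {x | Real.sqrt (∑ i, R i ^ 2) + 1 < ‖x‖}
        ≤ (n + 1) * ∑ i, ((ρ n).1.image a).real {x | R i < |x i|} := by
          gcongr
          exact (measureReal_mono hsub).trans (measureReal_iUnion_fintype_le _)
      _ = ∑ i, (n + 1) * ((ρ n).1.image₁ (a i)).real {x | R i < |x|} := by
          rw [Finset.mul_sum]
          refine Finset.sum_congr rfl fun i _ => ?_
          rw [hmap, map_measureReal_apply (by fun_prop)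
            (measurableSet_lt (by fun_prop) (by fun_prop))]
          rfl
      _ ≤ ∑ _i : Fin d, ε / (d + 1) := Finset.sum_le_sum fun i _ => htail i n
      _ ≤ ε := by
          rw [Finset.sum_const, Finset.card_univ, Fintype.card_fin, nsmul_eq_mul,
            ← mul_div_assoc, div_le_iff₀ (by positivity)]
          nlinarith

theorem exists_cylindricalMeasure_isLevyLimit (l : Ultrafilter ℕ)
    {μ : CylindricalProbabilityMeasure U} {ρ : ℕ → CylindricalProbabilityMeasure U}
    (h : ∀ (a : StrongDual ℝ U) n t,
      charFun ((ρ n).1.image₁ a) t ^ (n + 1) = charFun (μ.1.image₁ a) t) :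
    ∃ ν : CylindricalMeasure U, ∀ (d : ℕ) (a : Fin d → StrongDual ℝ U),
      IsLevyLimit l (fun n => (ρ n).1.image a) ((ν.image a).restrict {0}ᶜ) := by
  choose N hN using fun (d : ℕ) (a : Fin d → StrongDual ℝ U) => exists_isLevyLimit_image l h a
  obtain ⟨ν, hν⟩ := exists_cylindricalMeasure_of_consistent N
    (fun n m a b T hT B hB h0 => (hN n a).measure_eq_measure_preimage (hN m b) T
      (fun k => (ρ k).1.image_eq_map a b T.continuous.measurable hT) hB h0)
    (fun n a => (hN n a).measure_compl_submodule_eq_zero _ fun k => (ρ k).1.image_compl_range a)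
  -- The glued measure is only known to agree with `N d a` off the origin, and `N d a` has no mass
  -- there, so restriction recovers it.
  refine ⟨ν, fun d a => ?_⟩
  have hms : MeasurableSet ({0}ᶜ : Set (EuclideanSpace ℝ (Fin d))) :=
    (measurableSet_singleton 0).compl
  have heq : (ν.image a).restrict {0}ᶜ = N d a := by
    have h1 : (N d a).restrict {0}ᶜ = N d a :=
      Measure.restrict_eq_self_of_ae_mem (compl_mem_ae_iff.2 (hN d a).measure_zero)
    rw [← h1]
    ext B hB
    rw [Measure.restrict_apply hB, Measure.restrict_apply hB,
      hν d a _ (hB.inter hms) fun h0 => h0.2 rfl]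
  rw [heq]
  exact hN d a

end RootLevyLimit

/-! ### Integrals against the image Lévy measures -/

section LevyIntegrals

open Filter Topology

variable {U : Type*} [NormedAddCommGroup U] [NormedSpace ℝ U] (ν : CylindricalMeasure U)

theorem CylindricalMeasure.isLevy_of_restrict
    (h : ∀ (d : ℕ) (a : Fin d → StrongDual ℝ U),
      ∫⁻ x, min 1 (‖x‖ₑ ^ 2) ∂((ν.image a).restrict {0}ᶜ) < ∞) : ν.IsLevy := by
  intro d a
  rw [IsLevyMeasure, ← lintegral_add_compl _ (measurableSet_singleton 0),
    setLIntegral_congr_fun (g := fun _ => 0) (measurableSet_singleton 0)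
      (fun x hx => by simp [Set.mem_singleton_iff.1 hx]), lintegral_zero, zero_add]
  exact h d a

variable {ν}

theorem CylindricalMeasure.IsLevy.lintegral_image₁_lt_top (hν : ν.IsLevy) (b : StrongDual ℝ U) :
    ∫⁻ x, min 1 (‖x‖ₑ ^ 2) ∂((ν.image₁ b).restrict {0}ᶜ) < ∞ := by
  refine lt_of_le_of_lt (lintegral_mono' Measure.restrict_le_self le_rfl) ?_
  rw [ν.image₁_eq_map (fun _ : Fin 1 => b) b (f := fun x => x 0) (by fun_prop) fun u => rfl,
    lintegral_map (by fun_prop) (by fun_prop)]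
  refine lt_of_le_of_lt (lintegral_mono fun x => ?_) (hν 1 fun _ => b)
  gcongr
  exact PiLp.enorm_apply_le x 0

/-- The nonzero points of the kernel of `f` are missing on the left but present on the right; they
contribute nothing because `g` vanishes at 0. -/
theorem CylindricalMeasure.setIntegral_image₁_eq (ν : CylindricalMeasure U) {d : ℕ}
    (a : Fin d → StrongDual ℝ U) (b : StrongDual ℝ U)
    (f : StrongDual ℝ (EuclideanSpace ℝ (Fin d))) (hf : ∀ u, f (cylProj a u) = b u) {g : ℝ → ℝ}
    (hg : Measurable g) (hg0 : g 0 = 0) :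
    ∫ γ in ({0}ᶜ : Set ℝ), g γ ∂(ν.image₁ b) = ∫ x in {0}ᶜ, g (f x) ∂(ν.image a) := by
  have hfm : Measurable f := f.continuous.measurable
  rw [ν.image₁_eq_map a b hfm hf, setIntegral_map (measurableSet_singleton 0).compl
    hg.aestronglyMeasurable hfm.aemeasurable]
  refine (setIntegral_eq_of_subset_of_forall_sdiff_eq_zero
    (measurableSet_singleton 0).compl ?_ ?_).symm
  · intro x hx h0
    rw [Set.mem_singleton_iff.1 h0] at hx
    simp at hx
  · intro x hx
    have : f x = 0 := by simpa using hx.2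
    rw [this, hg0]

theorem two_mul_one_sub_cos_le_sq (y : ℝ) : 2 * (1 - Real.cos y) ≤ y ^ 2 := by
  linarith [Real.one_sub_sq_div_two_le_cos (x := y)]

theorem abs_two_mul_one_sub_cos_sub_sq_le (y : ℝ) :
    |2 * (1 - Real.cos y) - y ^ 2| ≤ 5 * |y| ^ 3 := by
  rcases le_total |y| 1 with h | h
  · have h1 := abs_le.1 (Real.cos_bound h)
    have h2 : |y| ^ 4 ≤ |y| ^ 3 := pow_le_pow_of_le_one (abs_nonneg y) h (by norm_num)
    have h3 : 0 ≤ |y| ^ 3 := by positivity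
    rw [abs_le]
    constructor <;> linarith
  · have h1 : 1 ≤ |y| ^ 3 := one_le_pow₀ h
    have h2 : y ^ 2 ≤ |y| ^ 3 := by
      rw [← sq_abs]
      exact pow_le_pow_right₀ h (by norm_num)
    rw [abs_le]
    constructor <;> linarith [Real.neg_one_le_cos y, Real.cos_le_one y, sq_nonneg y]

theorem norm_two_mul_one_sub_cos_le {E : Type*} [NormedAddCommGroup E] [NormedSpace ℝ E]
    (f : StrongDual ℝ E) (x : E) :
    |2 * (1 - Real.cos (f x))| ≤ (‖f‖ ^ 2 + 4) * min 1 (‖x‖ ^ 2) := by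
  have h0 := Real.cos_le_one (f x)
  have h1 := Real.neg_one_le_cos (f x)
  have h2 : f x ^ 2 ≤ ‖f‖ ^ 2 * ‖x‖ ^ 2 := by
    rw [← mul_pow, ← sq_abs]
    exact pow_le_pow_left₀ (abs_nonneg _) (f.le_opNorm x) 2
  rw [abs_of_nonneg (by linarith), mul_min_of_nonneg _ _ (by positivity)]
  refine le_min ?_ ?_
  · nlinarith [sq_nonneg ‖f‖]
  · nlinarith [two_mul_one_sub_cos_le_sq (f x), sq_nonneg ‖x‖]

end LevyIntegrals

/-! ### The Gaussian part is a quadratic form -/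

section GaussianPart

open Filter Topology

variable {U : Type*} [NormedAddCommGroup U] [NormedSpace ℝ U]

/-- The second-order Taylor terms add up to `∑ w_j f_j² = 0`, which leaves a cubic remainder near
the origin; far away `2(1 - cos) ≤ 4` is enough. -/
theorem abs_sum_two_mul_one_sub_cos_le {E : Type*} [NormedAddCommGroup E] [NormedSpace ℝ E]
    {m : ℕ} (f : Fin m → StrongDual ℝ E) (w : Fin m → ℝ) (hw : ∀ x, ∑ j, w j * f j x ^ 2 = 0)
    (x : E) : |∑ j, w j * (2 * (1 - Real.cos (f j x)))|
      ≤ (∑ j, |w j| * (5 * ‖f j‖ ^ 3 + 4)) * min 1 (‖x‖ ^ 3) := by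
  have hnn : 0 ≤ ∑ j, |w j| * (5 * ‖f j‖ ^ 3 + 4) := by positivity
  rw [mul_min_of_nonneg _ _ hnn, mul_one]
  refine le_min ?_ ?_
  · refine (Finset.abs_sum_le_sum_abs _ _).trans (Finset.sum_le_sum fun j _ => ?_)
    rw [abs_mul]
    gcongr
    have h1 : 0 ≤ 5 * ‖f j‖ ^ 3 := by positivity
    rw [abs_le]
    constructor <;> linarith [Real.cos_le_one (f j x), Real.neg_one_le_cos (f j x)]
  · have e : ∑ j, w j * (2 * (1 - Real.cos (f j x)))
        = ∑ j, w j * (2 * (1 - Real.cos (f j x)) - f j x ^ 2) := by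
      simp only [mul_sub, Finset.sum_sub_distrib] at hw ⊢
      rw [hw x, sub_zero]
    rw [e, Finset.sum_mul]
    refine (Finset.abs_sum_le_sum_abs _ _).trans (Finset.sum_le_sum fun j _ => ?_)
    rw [abs_mul, mul_assoc]
    gcongr
    refine (abs_two_mul_one_sub_cos_sub_sq_le _).trans ?_
    have h1 : |f j x| ^ 3 ≤ ‖f j‖ ^ 3 * ‖x‖ ^ 3 := by
      rw [← mul_pow]
      exact pow_le_pow_left₀ (abs_nonneg _) ((f j).le_opNorm x) 3
    have h2 : 0 ≤ ‖x‖ ^ 3 := by positivity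
    linarith

theorem integrable_two_mul_one_sub_cos {Q : Measure ℝ} [IsProbabilityMeasure Q] :
    Integrable (fun x => 2 * (1 - Real.cos x)) Q := by
  refine Integrable.of_bound (C := 4) (by fun_prop) (ae_of_all _ fun x => ?_)
  rw [Real.norm_eq_abs, abs_le]
  constructor <;> linarith [Real.cos_le_one x, Real.neg_one_le_cos x]

theorem integral_two_mul_one_sub_cos (Q : Measure ℝ) [IsProbabilityMeasure Q] :
    ∫ x, 2 * (1 - Real.cos x) ∂Q = -2 * (charFun Q 1 - 1).re := by
  have hint : Integrable (fun x : ℝ => Complex.exp (x * Complex.I)) Q := by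
    refine Integrable.of_bound (C := 1) (by fun_prop) (ae_of_all _ fun x => ?_)
    rw [Complex.norm_exp_ofReal_mul_I]
  have h3 := integral_re hint
  simp only [RCLike.re_eq_complex_re, Complex.exp_ofReal_mul_I_re] at h3
  have hc : Integrable (fun x : ℝ => Real.cos x) Q := by
    simpa only [RCLike.re_eq_complex_re, Complex.exp_ofReal_mul_I_re] using hint.re
  rw [integral_const_mul, integral_sub (integrable_const _) hc, h3, charFun_apply_real]
  simp only [Complex.ofReal_one, one_mul, integral_const, probReal_univ, smul_eq_mul, mul_one,
    Complex.sub_re, Complex.one_re]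
  ring

/-- The Gaussian variance left in an exponent `z` after the contribution of the Lévy measure to
`-2 Re z` is removed. -/
noncomputable def gaussianPart (ν : CylindricalMeasure U) (z : StrongDual ℝ U → ℂ)
    (b : StrongDual ℝ U) : ℝ :=
  -2 * (z b).re - ∫ γ in ({0}ᶜ : Set ℝ), 2 * (1 - Real.cos γ) ∂(ν.image₁ b)

variable {l : Filter ℕ} [l.NeBot] {ρ : ℕ → CylindricalProbabilityMeasure U}
  {ν : CylindricalMeasure U} {z : StrongDual ℝ U → ℂ}

/-- The third-order combination of cosines has two expressions for its limit: its `ν`-integral,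
since nothing is lost at the origin, and the combination of the numbers `-2 Re z(b_j)`. Their
difference is the claim. -/
theorem sum_gaussianPart_eq_zero
    (hν : ∀ (d : ℕ) (a : Fin d → StrongDual ℝ U),
      IsLevyLimit l (fun n => (ρ n).1.image a) ((ν.image a).restrict {0}ᶜ))
    (hz : ∀ b : StrongDual ℝ U, Tendsto
      (fun n : ℕ => (n + 1 : ℂ) * (charFun ((ρ n).1.image₁ b) 1 - 1)) l (𝓝 (z b)))
    {d m : ℕ} (a : Fin d → StrongDual ℝ U) (b : Fin m → StrongDual ℝ U)
    (f : Fin m → StrongDual ℝ (EuclideanSpace ℝ (Fin d))) (w : Fin m → ℝ)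
    (hf : ∀ j u, f j (cylProj a u) = b j u) (hw : ∀ x, ∑ j, w j * f j x ^ 2 = 0) :
    ∑ j, w j * gaussianPart ν z (b j) = 0 := by
  have hprob := fun n j => (ρ n).isProbabilityMeasure_image₁ (b j)
  have hproba := fun n => (ρ n).isProbabilityMeasure_image a
  have hlim := (hν d a).tendsto (fun x => ∑ j, w j * (2 * (1 - Real.cos (f j x)))) (by fun_prop)
    ⟨_, abs_sum_two_mul_one_sub_cos_le f w hw⟩
  have hre : ∀ j, Tendsto (fun n : ℕ => (n + 1 : ℝ) *
      ∫ γ, 2 * (1 - Real.cos γ) ∂((ρ n).1.image₁ (b j))) l (𝓝 (-2 * (z (b j)).re)) := by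
    intro j
    refine (((Complex.continuous_re.tendsto _).comp (hz (b j))).const_mul (-2)).congr fun n => ?_
    rw [integral_two_mul_one_sub_cos, Function.comp,
      show (n + 1 : ℂ) = ((n + 1 : ℝ) : ℂ) by push_cast; rfl, Complex.re_ofReal_mul]
    ring
  have hsum := tendsto_finsetSum Finset.univ fun j _ => (hre j).const_mul (w j)
  have hleft : ∀ n : ℕ, (n + 1 : ℝ) *
      ∫ x, ∑ j, w j * (2 * (1 - Real.cos (f j x))) ∂((ρ n).1.image a)
      = ∑ j, w j * ((n + 1 : ℝ) * ∫ γ, 2 * (1 - Real.cos γ) ∂((ρ n).1.image₁ (b j))) := by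
    intro n
    have hmap := fun j =>
      (ρ n).1.image₁_eq_map a (b j) (f j).continuous.measurable (hf j)
    rw [integral_finsetSum, Finset.mul_sum]
    · refine Finset.sum_congr rfl fun j _ => ?_
      rw [hmap j, integral_map (by fun_prop) (by fun_prop), integral_const_mul]
      ring
    · intro j _
      refine Integrable.const_mul ?_ _
      have := integrable_two_mul_one_sub_cos (Q := (ρ n).1.image₁ (b j))
      rw [hmap j, integrable_map_measure (by fun_prop) (by fun_prop)] at this
      exact this
  have hright : ∫ x in {0}ᶜ, ∑ j, w j * (2 * (1 - Real.cos (f j x))) ∂(ν.image a)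
      = ∑ j, w j * ∫ γ in ({0}ᶜ : Set ℝ), 2 * (1 - Real.cos γ) ∂(ν.image₁ (b j)) := by
    rw [integral_finsetSum]
    · refine Finset.sum_congr rfl fun j _ => ?_
      rw [ν.setIntegral_image₁_eq a (b j) (f j) (hf j) (g := fun γ => 2 * (1 - Real.cos γ))
        (by fun_prop) (by simp), integral_const_mul]
    · intro j _
      exact (integrable_of_abs_le_min_one_sq (hν d a).lintegral_lt_top (by fun_prop)
        (norm_two_mul_one_sub_cos_le (f j))).const_mul _
  have huniq := tendsto_nhds_unique (hlim.congr hleft) hsum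
  rw [hright] at huniq
  simp only [gaussianPart, mul_sub, Finset.sum_sub_distrib] at huniq ⊢
  linarith

theorem exists_quadraticForm_eq_gaussianPart
    (hν : ∀ (d : ℕ) (a : Fin d → StrongDual ℝ U),
      IsLevyLimit l (fun n => (ρ n).1.image a) ((ν.image a).restrict {0}ᶜ))
    (hz : ∀ b : StrongDual ℝ U, Tendsto
      (fun n : ℕ => (n + 1 : ℂ) * (charFun ((ρ n).1.image₁ b) 1 - 1)) l (𝓝 (z b))) :
    ∃ s : QuadraticForm ℝ (StrongDual ℝ U), ∀ b, s b = gaussianPart ν z b := by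
  refine ⟨QuadraticMap.ofPolar (gaussianPart ν z) (fun c x => ?_) (fun x x' y => ?_)
    (fun c x y => ?_), fun b => rfl⟩
  -- Homogeneity, then additivity and homogeneity of the polar form in its first argument, each
  -- arise from a polynomial identity between squares of linear forms in the coordinates.
  · have := sum_gaussianPart_eq_zero hν hz ![x] ![c • x, x]
      ![c • EuclideanSpace.proj 0, EuclideanSpace.proj 0] ![1, -(c * c)]
      (by intro j u; fin_cases j <;> simp [cylProj])
      (by intro x; simp [Fin.sum_univ_succ]; ring)
    simp [Fin.sum_univ_succ] at this
    rw [smul_eq_mul]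
    linarith
  · have := sum_gaussianPart_eq_zero hν hz ![x, x', y] ![x + x' + y, x + x', y, x + y, x, x' + y, x']
      ![EuclideanSpace.proj 0 + EuclideanSpace.proj 1 + EuclideanSpace.proj 2,
        EuclideanSpace.proj 0 + EuclideanSpace.proj 1, EuclideanSpace.proj 2,
        EuclideanSpace.proj 0 + EuclideanSpace.proj 2, EuclideanSpace.proj 0,
        EuclideanSpace.proj 1 + EuclideanSpace.proj 2, EuclideanSpace.proj 1]
      ![1, -1, 1, -1, 1, -1, 1]
      (by intro j u; fin_cases j <;> simp [cylProj])
      (by intro x; simp [Fin.sum_univ_succ]; ring)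
    simp [Fin.sum_univ_succ] at this
    simp only [QuadraticMap.polar]
    linarith
  · have := sum_gaussianPart_eq_zero hν hz ![x, y] ![c • x + y, c • x, y, x + y, x]
      ![c • EuclideanSpace.proj 0 + EuclideanSpace.proj 1, c • EuclideanSpace.proj 0,
        EuclideanSpace.proj 1, EuclideanSpace.proj 0 + EuclideanSpace.proj 1,
        EuclideanSpace.proj 0]
      ![1, -1, c - 1, -c, c]
      (by intro j u; fin_cases j <;> simp [cylProj])
      (by intro x; simp [Fin.sum_univ_succ]; ring)
    simp [Fin.sum_univ_succ] at this
    simp only [QuadraticMap.polar, smul_eq_mul]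
    linarith

end GaussianPart

/-! ### Assembling the exponent -/

section LevyKhintchine

open Filter Topology

variable {U : Type*} [NormedAddCommGroup U] [NormedSpace ℝ U]

theorem abs_sin_sub_indicator_le (γ : ℝ) :
    |Real.sin γ - Set.indicator (Set.Icc (-1 : ℝ) 1) (fun x => x) γ| ≤ 1 * min 1 (‖γ‖ ^ 2) := by
  have hmem : γ ∈ Set.Icc (-1 : ℝ) 1 ↔ |γ| ≤ 1 := by rw [Set.mem_Icc, abs_le]
  rw [one_mul, Real.norm_eq_abs]
  rcases le_or_gt |γ| 1 with h | h
  · rw [Set.indicator_of_mem (hmem.2 h), min_eq_right (pow_le_one₀ (abs_nonneg _) h), sq_abs]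
    have h1 := (Complex.abs_im_le_norm _).trans (norm_exp_mul_I_sub_one_sub_le h)
    simpa [Complex.exp_ofReal_mul_I_im] using h1
  · rw [Set.indicator_of_notMem (fun hm => h.not_ge (hmem.1 hm)), min_eq_left (one_le_pow₀ h.le),
      sub_zero]
    exact Real.abs_sin_le_one γ

/-- Real and imaginary parts are separately integrable, both being `O(min(1, γ²))`. The real part is
what `gaussianPart` subtracts; the imaginary part goes into `r`. -/
theorem integral_levy_khintchine_eq {m : Measure ℝ} (hm : ∫⁻ x, min 1 (‖x‖ₑ ^ 2) ∂m < ∞) :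
    ∫ γ, (Complex.exp (Complex.I * (γ : ℂ)) - 1
        - Complex.I * (γ : ℂ) * Set.indicator (Set.Icc (-1 : ℝ) 1) (fun _ => (1 : ℂ)) γ) ∂m
      = -(((1 / 2 : ℝ) * ∫ γ, 2 * (1 - Real.cos γ) ∂m : ℝ) : ℂ) + Complex.I *
        ((∫ γ, (Real.sin γ - Set.indicator (Set.Icc (-1 : ℝ) 1) (fun x => x) γ) ∂m : ℝ) : ℂ) := by
  have h1 : Integrable (fun γ : ℝ => 2 * (1 - Real.cos γ)) m :=
    integrable_of_abs_le_min_one_sq hm (by fun_prop)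
      (norm_two_mul_one_sub_cos_le (ContinuousLinearMap.id ℝ ℝ))
  have h2 : Integrable
      (fun γ : ℝ => Real.sin γ - Set.indicator (Set.Icc (-1 : ℝ) 1) (fun x => x) γ) m :=
    integrable_of_abs_le_min_one_sq hm
      (Real.measurable_sin.sub (measurable_id.indicator measurableSet_Icc))
      abs_sin_sub_indicator_le
  have h1' : Integrable (fun γ : ℝ => -(((1 / 2 : ℝ) * (2 * (1 - Real.cos γ)) : ℝ) : ℂ)) m :=
    (h1.const_mul _).ofReal.neg
  have h2' : Integrable (fun γ : ℝ => Complex.I *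
      ((Real.sin γ - Set.indicator (Set.Icc (-1 : ℝ) 1) (fun x => x) γ : ℝ) : ℂ)) m :=
    h2.ofReal.const_mul _
  rw [← integral_const_mul, ← integral_complex_ofReal, ← integral_complex_ofReal, ← integral_neg,
    ← integral_const_mul, ← integral_add h1' h2']
  refine integral_congr_ae (ae_of_all _ fun γ => ?_)
  beta_reduce
  rw [mul_comm Complex.I (γ : ℂ), Complex.exp_mul_I]
  by_cases hγ : γ ∈ Set.Icc (-1 : ℝ) 1
  · simp only [Set.indicator_of_mem hγ]
    push_cast
    ring
  · simp only [Set.indicator_of_notMem hγ]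
    push_cast
    ring

end LevyKhintchine

theorem mainTheorem2 {U : Type*} [NormedAddCommGroup U] [NormedSpace ℝ U] [CompleteSpace U]
    [TopologicalSpace.SeparableSpace U] (μ : CylindricalProbabilityMeasure U)
    (hμ : μ.IsInfinitelyDivisible) :
    ∃ (r : StrongDual ℝ U → ℝ) (s : QuadraticForm ℝ (StrongDual ℝ U)) (ν : CylindricalMeasure U),
      ν.IsLevy ∧
      ∀ a : StrongDual ℝ U,
        μ.1.charFn a = Complex.exp
          (Complex.I * (r a : ℂ) - 1 / 2 * (s a : ℂ)
            + ∫ γ in ({0}ᶜ : Set ℝ),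
                (Complex.exp (Complex.I * (γ : ℂ)) - 1
                  - Complex.I * (γ : ℂ) * Set.indicator (Set.Icc (-1 : ℝ) 1) (fun _ => (1 : ℂ)) γ)
                ∂(ν.image₁ a)) := by
  choose ρ hρ using fun n : ℕ => hμ (n + 1) (Nat.le_add_left 1 n)
  let l : Ultrafilter ℕ := Filter.hyperfilter ℕ
  have hroot : ∀ (a : StrongDual ℝ U) (n : ℕ) (t : ℝ),
      charFun ((ρ n).1.image₁ a) t ^ (n + 1) = charFun (μ.1.image₁ a) t := fun a n t => by
    conv_rhs => rw [hρ n]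
    rw [CylindricalProbabilityMeasure.charFun_image₁_convPow]
  have hprob := fun a => μ.isProbabilityMeasure_image₁ a
  have hprob' := fun n a => (ρ n).isProbabilityMeasure_image₁ a
  obtain ⟨ν, hν⟩ := exists_cylindricalMeasure_isLevyLimit l hroot
  have hlim : ∀ a : StrongDual ℝ U, ∃ z : ℂ, Filter.Tendsto
      (fun n : ℕ => (n + 1 : ℂ) * (charFun ((ρ n).1.image₁ a) 1 - 1)) l (nhds z) := by
    intro a
    obtain ⟨C, hC⟩ := exists_forall_norm_charFun_root_one_sub_one_le (hroot a)
    have hmem : ∀ n : ℕ, (n + 1 : ℂ) * (charFun ((ρ n).1.image₁ a) 1 - 1)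
        ∈ Metric.closedBall (0 : ℂ) C := fun n => by
      have h1 : ‖(n + 1 : ℂ)‖ = n + 1 := by exact_mod_cast Complex.norm_natCast (n + 1)
      rw [mem_closedBall_zero_iff, norm_mul, h1]
      exact hC n
    obtain ⟨z, -, hz⟩ := (isCompact_closedBall (0 : ℂ) C).ultrafilter_le_nhds
      (l.map fun n : ℕ => (n + 1 : ℂ) * (charFun ((ρ n).1.image₁ a) 1 - 1))
      (Filter.le_principal_iff.2 (Filter.mem_map.2 (Filter.univ_mem' hmem)))
    exact ⟨z, hz⟩
  choose z hz using hlim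
  obtain ⟨s, hs⟩ := exists_quadraticForm_eq_gaussianPart hν hz
  have hLevy : ν.IsLevy := ν.isLevy_of_restrict fun d a => (hν d a).lintegral_lt_top
  -- `r` is defined as the imaginary part of `z` that the compensated integral does not supply.
  refine ⟨fun a => (z a).im - ∫ γ in ({0}ᶜ : Set ℝ),
    (Real.sin γ - Set.indicator (Set.Icc (-1 : ℝ) 1) (fun x => x) γ) ∂(ν.image₁ a), s, ν, hLevy,
    fun a => ?_⟩
  have hexp : μ.1.charFn a = Complex.exp (z a) := by
    rw [CylindricalMeasure.charFn_eq_charFun_image₁]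
    -- The powers `(1 + (φ_{ρ n} - 1))^(n+1)` all equal `φ_μ(a)`, so their limit `exp (z a)` is that
    -- constant.
    refine tendsto_nhds_unique ?_ (tendsto_one_add_pow_succ_exp Nat.hyperfilter_le_atTop (hz a))
    simp only [add_sub_cancel, hroot a]
    exact tendsto_const_nhds
  rw [hexp, integral_levy_khintchine_eq (hLevy.lintegral_image₁_lt_top a), hs, gaussianPart]
  congr 1
  conv_lhs => rw [← Complex.re_add_im (z a)]
  push_cast
  ring
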